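/- A convex body in $\mathbb{R}^2$ is a compact convex set $K\subset\mathbb{R}^2$ with nonempty interior; it is called $C^1$ regular if every boundary point of $K$ lies on exactly one supporting line of $K$. The covariogram of $K$ is the function $g_K(x)=V_2(K\cap(K+x))$, $x\in\mathbb{R}^2$, where $V_2$ is Lebesgue measure, and $G(x)=G(K,x)=\left[\frac{\partial^2 g_K(x)}{\partial x_i\,\partial x_j}\right]_{i,j=1}^2$ denotes its Hessian matrix. Let $K$ be a strictly convex and $C^1$ regular convex body in $\mathbb{R}^2$, and let $x\in\operatorname{int}\operatorname{supp} g_K\setminus\{o\}$ satisfy $\det G(x)\neq -1$. Then there are uniquely determined points $p_1(K,x),\dots,p_4(K,x)$ in counterclockwise order on the boundary of $K$, the vertices of a nondegenerate parallelogram, such that $x=p_1(K,x)-p_2(K,x)=p_4(K,x)-p_3(K,x)$, and $K$ has exactly one outer unit normal $u_i(K,x)$ at each $p_i(K,x)$. Moreover, the set $\{u_1(K,x),-u_3(K,x)\}$ is uniquely determined by $g_K$: for every strictly convex and $C^1$ regular convex body $L$ in $\mathbb{R}^2$ with $g_L=g_K$, the points $p_i(L,x)$ and normals $u_i(L,x)$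 exist and are unique in the same sense, and $$\{u_1(K,x),-u_3(K,x)\}=\{u_1(L,x),-u_3(L,x)\}.$$ -/

import Mathlib

open scoped RealInnerProductSpace

noncomputable section

/-- The Euclidean plane. -/
abbrev Plane : Type := EuclideanSpace ℝ (Fin 2)

/-- The determinant of the matrix with columns `a`, `b`. -/
def planeDet (a b : Plane) : ℝ := a 0 * b 1 - a 1 * b 0

/-- The covariogram `x ↦ V₂(K ∩ (K + x))` of a subset of the plane. -/
def covariogram (K : Set Plane) (x : Plane) : ℝ :=
  MeasureTheory.volume.real (K ∩ (fun y => y + x) '' K)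

/-- The partial derivative of `g` with respect to the `i`-th coordinate. -/
def partialDeriv (i : Fin 2) (g : Plane → ℝ) (x : Plane) : ℝ :=
  lineDeriv ℝ g x (EuclideanSpace.single i 1)

/-- The Hessian matrix of second partial derivatives of `g` at `x`. -/
def hessianMatrix (g : Plane → ℝ) (x : Plane) : Matrix (Fin 2) (Fin 2) ℝ :=
  Matrix.of fun i j => partialDeriv i (partialDeriv j g) x

/-- `u` is an outer normal vector (possibly zero) of `K` at the point `p`. -/
def IsOuterNormal (K : Set Plane) (p u : Plane) : Prop :=
  ∀ y ∈ K, ⟪u, y⟫ ≤ ⟪u, p⟫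

/-- `H` is a line supporting `K` at the point `p`. -/
def IsSupportingLine (K : Set Plane) (p : Plane) (H : Set Plane) : Prop :=
  ∃ u : Plane, u ≠ 0 ∧ IsOuterNormal K p u ∧ H = {y | ⟪u, y⟫ = ⟪u, p⟫}

/-- `K` is `C¹` regular: through each boundary point there is precisely one supporting line. -/
def IsC1Regular (K : Set Plane) : Prop :=
  ∀ p ∈ frontier K, ∃! H : Set Plane, IsSupportingLine K p H

/-- The points `p 0, p 1, p 2, p 3` are, in this order, the vertices of a convex quadrilateral
listed counterclockwise: every triple taken in the order of the indices turns to the left. -/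
def IsCounterclockwise (p : Fin 4 → Plane) : Prop :=
  ∀ i j k : Fin 4, i < j → j < k → 0 < planeDet (p j - p i) (p k - p i)

/-- `p` lists the vertices `p₁, …, p₄` (here with the indices `0, …, 3`) of the parallelogram
`P(K, x)` inscribed in `K`, and `u` lists the outer unit normals `u₁, …, u₄` of `K` at them:
the `pᵢ` are boundary points of `K` in counterclockwise order, and `x = p₁ - p₂ = p₄ - p₃`. -/
structure IsInscribedParallelogram (K : Set Plane) (x : Plane) (p u : Fin 4 → Plane) : Prop where
  mem_frontier : ∀ i, p i ∈ frontier K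
  counterclockwise : IsCounterclockwise p
  top_edge : x = p 0 - p 1
  bottom_edge : x = p 3 - p 2
  norm_normal : ∀ i, ‖u i‖ = 1
  normal : ∀ i, IsOuterNormal K (p i) (u i)

end

/-!
For a vector `x` the inscribed parallelogram is found on the boundary of `K ∩ (K + x)`: its
vertices `p 0` and `p 3` are the extreme points of that set in the two directions perpendicular to
`x`. Write `D(x) = p 0 - p 3` for the second edge. The line through `p 0` and `p 3` splits
`K ∩ (K + x)` into a part of `K` and a part of `K + x`, and comparing with the translates by nearby
vectors gives a second order upper bound for the covariogram, locally uniform in `x`. Hence the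
covariogram is differentiable, and its gradient is `D` turned by a right angle
(`IsSmoothBody.hasFDerivAt_covariogram`). The vertices move tangentially to the boundary, so `D` is
differentiable as well, and its derivative is a difference of two rank one projections which only
depends on the normals `u i` (`IsSmoothBody.hasFDerivAt_side`). Its determinant is that of the
Hessian, and it is `-1` when `u 0 = -u 2`. So the hypothesis on the Hessian implies that `u 0`
and `-u 2` are linearly independent, and two bodies with the same covariogram have the same `D` and the
same derivative of `D`.

Let `K` and `L` have the same covariogram, with normals `u` and `v`. Reflecting either body in the
origin exchanges `u 0` and `-u 2`, so one may assume that the basis `-u 2, u 0` is positively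
oriented, and likewise for `v`. On the set of all such `x` the claim is `u 0 = v 0` (`IsCovariogramPair.nrm_zero_eq`). The
angle between `u 0` and `v 0` tends to `0` at the boundary of this set: as `x → 0` both normals
become perpendicular to `x`, as `x` tends to the boundary of `K - K = L - L` both tend to the normal
of that body, and if `u 0 = -u 2` then the diagonal `p 0 - p 2` ends on that boundary, with normal
`u 0`. Thus the angle attains its maximum if it is not identically `0`. At a positive maximum, say
with `v 0` ahead of `u 0`, two motions of the parallelogram in `K` are used.

* Fix `p 0` and move `p 1` along the boundary. This leaves `u 0` unchanged and turns `v 0` away from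
  it, unless `u 1 = v 1` (`IsCovariogramPair.nrm_one_eq_of_min`). In the latter case equality of the
  derivatives of `D` forces `u 3 = v 3 = -u 1` and an order of `u 2` and `v 2`
  (`IsCovariogramPair.normals_of_nrm_one_eq`).
* Fix `p 1` and move `p 0`. This turns `v 1` ahead of `u 1`, and `u 3` behind `-u 1`. The slopes of
  the normals of `L`, relative to the common edges, then enclose those of `K`. But the derivative of
  `D` determines the cross ratio of the four slopes, which is strictly monotone under such nesting
  (`slopes_not_nested`), a contradiction.

Once `u 0 = v 0`, the derivative of `D` in the direction tangential to the boundary at `p 0` gives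
`u 2 = v 2` (`IsCovariogramPair.nrm_two_eq`).
-/

noncomputable section

open scoped Pointwise

/-! ### Linear algebra of the plane -/

lemma plane_inner_eq (a b : Plane) : ⟪a, b⟫ = a 0 * b 0 + a 1 * b 1 := by
  simp [PiLp.inner_apply, Fin.sum_univ_two]; ring

/-- Rotation of the plane by a right angle, counterclockwise. -/
def quarterTurn (a : Plane) : Plane := !₂[-a 1, a 0]

@[simp] lemma quarterTurn_zero_coord (a : Plane) : quarterTurn a 0 = -a 1 := by
  simp [quarterTurn]

@[simp] lemma quarterTurn_one_coord (a : Plane) : quarterTurn a 1 = a 0 := by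
  simp [quarterTurn]

lemma inner_quarterTurn (a b : Plane) : ⟪a, quarterTurn b⟫ = planeDet b a := by
  simp [plane_inner_eq, planeDet]; ring

lemma planeDet_swap (a b : Plane) : planeDet a b = -planeDet b a := by
  simp only [planeDet]; ring

lemma planeDet_mul_planeDet (u v a b : Plane) :
    planeDet u v * planeDet a b = ⟪u, a⟫ * ⟪v, b⟫ - ⟪u, b⟫ * ⟪v, a⟫ := by
  simp only [planeDet, plane_inner_eq]; ring

lemma plane_ext {a b : Plane} (h0 : a 0 = b 0) (h1 : a 1 = b 1) : a = b := by
  ext i; fin_cases i <;> assumption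

lemma planeDet_smul_eq (u v a : Plane) :
    planeDet u v • a = ⟪v, a⟫ • quarterTurn u - ⟪u, a⟫ • quarterTurn v := by
  apply plane_ext <;> simp [planeDet, plane_inner_eq] <;> ring

lemma norm_quarterTurn (a : Plane) : ‖quarterTurn a‖ = ‖a‖ := by
  rw [EuclideanSpace.norm_eq, EuclideanSpace.norm_eq]
  simp [Fin.sum_univ_two, add_comm]

lemma unit_coord {u : Plane} (hu : ‖u‖ = 1) : u 0 ^ 2 + u 1 ^ 2 = 1 := by
  have h := EuclideanSpace.norm_sq_eq u
  simp [Fin.sum_univ_two, hu] at h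
  linarith

/-- Two unit vectors spanning the same line are equal once some vector has positive
inner product with both. -/
lemma unit_eq_of_planeDet_eq_zero {u v w : Plane} (hu : ‖u‖ = 1) (hv : ‖v‖ = 1)
    (h : planeDet u v = 0) (h1 : 0 < ⟪u, w⟫) (h2 : 0 < ⟪v, w⟫) : u = v := by
  have hu' := unit_coord hu
  have hv' := unit_coord hv
  have hs : v = ⟪u, v⟫ • u := by
    apply plane_ext <;> simp only [PiLp.smul_apply, smul_eq_mul, plane_inner_eq] <;>
      simp only [planeDet] at h
    · linear_combination (-u 1) * h - v 0 * hu'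
    · linear_combination (u 0) * h - v 1 * hu'
  have hpos : 0 < ⟪u, v⟫ := by
    rw [hs, inner_smul_left] at h2
    simp only [conj_trivial] at h2
    exact pos_of_mul_pos_left h2 h1.le
  have hone : ⟪u, v⟫ = 1 := by
    have : ‖v‖ = |⟪u, v⟫| * ‖u‖ := by
      conv_lhs => rw [hs]
      rw [norm_smul, Real.norm_eq_abs]
    rw [hu, hv, abs_of_pos hpos] at this
    linarith
  rw [hs, hone, one_smul]

/-- The projection of the plane onto the line orthogonal to `u`, along the line orthogonal
to `v`. -/
def obliqueProj (u v : Plane) : Plane →L[ℝ] Plane :=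
  (planeDet u v)⁻¹ • (innerSL ℝ v).smulRight (quarterTurn u)

lemma obliqueProj_apply (u v h : Plane) :
    obliqueProj u v h = (⟪v, h⟫ / planeDet u v) • quarterTurn u := by
  simp [obliqueProj, smul_smul, div_eq_inv_mul]

lemma planeDet_obliqueProj (u v z w : Plane) :
    planeDet (obliqueProj u v z) w = -(⟪v, z⟫ * ⟪u, w⟫ / planeDet u v) := by
  rw [obliqueProj_apply]
  simp only [planeDet, plane_inner_eq, PiLp.smul_apply, smul_eq_mul, quarterTurn_zero_coord,
    quarterTurn_one_coord]
  ring

lemma obliqueProj_sub_self {u v : Plane} (h : planeDet u v ≠ 0) (z : Plane) :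
    obliqueProj u v z - z = (⟪u, z⟫ / planeDet u v) • quarterTurn v := by
  have := planeDet_smul_eq u v z
  rw [obliqueProj_apply, sub_eq_iff_eq_add, ← sub_eq_iff_eq_add']
  have h2 : z = (planeDet u v)⁻¹ • (planeDet u v • z) := by
    rw [smul_smul, inv_mul_cancel₀ h, one_smul]
  conv_rhs => rw [h2, this]
  rw [smul_sub, smul_smul, smul_smul, div_eq_inv_mul, div_eq_inv_mul]

/-! ### Strictly convex and smooth bodies -/

/-- A strictly convex and `C¹` regular convex body, as a set. -/
structure IsSmoothBody (K : Set Plane) : Prop where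
  compact : IsCompact K
  convex : Convex ℝ K
  nonempty_interior : (interior K).Nonempty
  strictConvex : StrictConvex ℝ K
  regular : IsC1Regular K

variable {K L : Set Plane}

lemma IsSmoothBody.frontier_subset (hK : IsSmoothBody K) : frontier K ⊆ K :=
  hK.compact.isClosed.frontier_subset

lemma IsSmoothBody.closure_interior (hK : IsSmoothBody K) : closure (interior K) = K := by
  rw [hK.convex.closure_interior_eq_closure_of_nonempty_interior hK.nonempty_interior,
    hK.compact.isClosed.closure_eq]

/-- A non-trivial linear functional has no maximum at an interior point. -/
lemma exists_gt_of_mem_interior {z u : Plane} (hz : z ∈ interior K) (hu : u ≠ 0) :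
    ∃ y ∈ K, ⟪u, z⟫ < ⟪u, y⟫ := by
  have hc : Filter.Tendsto (fun t : ℝ => z + t • u) (nhdsWithin 0 (Set.Ioi 0)) (nhds z) := by
    have : Continuous fun t : ℝ => z + t • u := by fun_prop
    have h := this.tendsto 0
    simp only [zero_smul, add_zero] at h
    exact h.mono_left nhdsWithin_le_nhds
  have h1 := hc.eventually (mem_interior_iff_mem_nhds.1 hz)
  obtain ⟨t, ht, ht0⟩ := (h1.and self_mem_nhdsWithin).exists
  refine ⟨_, ht, ?_⟩
  rw [inner_add_right, inner_smul_right]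
  have : 0 < ⟪u, u⟫ := real_inner_self_pos.2 hu
  have ht0 : 0 < t := ht0
  nlinarith [mul_pos ht0 this]

lemma IsOuterNormal.lt_of_mem_interior {p u z : Plane} (h : IsOuterNormal K p u) (hu : u ≠ 0)
    (hz : z ∈ interior K) : ⟪u, z⟫ < ⟪u, p⟫ := by
  obtain ⟨y, hy, hzy⟩ := exists_gt_of_mem_interior hz hu
  exact hzy.trans_le (h y hy)

lemma ne_zero_of_norm_one {u : Plane} (hu : ‖u‖ = 1) : u ≠ 0 := by
  rintro rfl; simp at hu

lemma IsOuterNormal.lt (hK : IsSmoothBody K) {p u y : Plane} (h : IsOuterNormal K p u)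
    (hu : ‖u‖ = 1) (hp : p ∈ K) (hy : y ∈ K) (hne : y ≠ p) : ⟪u, y⟫ < ⟪u, p⟫ := by
  have hm := hK.strictConvex hy hp hne (a := 1/2) (b := 1/2) (by norm_num) (by norm_num)
    (by norm_num)
  have := h.lt_of_mem_interior (ne_zero_of_norm_one hu) hm
  rw [inner_add_right, inner_smul_right, inner_smul_right] at this
  linarith

lemma IsSmoothBody.exists_normal (hK : IsSmoothBody K) {p : Plane} (hp : p ∈ frontier K) :
    ∃ u : Plane, ‖u‖ = 1 ∧ IsOuterNormal K p u := by
  obtain ⟨H, ⟨u, hu, hn, -⟩, -⟩ := hK.regular p hp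
  refine ⟨‖u‖⁻¹ • u, norm_smul_inv_norm (𝕜 := ℝ) hu, fun y hy => ?_⟩
  simp only [inner_smul_left, conj_trivial]
  exact mul_le_mul_of_nonneg_left (hn y hy) (by positivity)

lemma IsSmoothBody.normal_unique (hK : IsSmoothBody K) {p u v : Plane} (hp : p ∈ frontier K)
    (hu : ‖u‖ = 1) (hun : IsOuterNormal K p u) (hv : ‖v‖ = 1) (hvn : IsOuterNormal K p v) :
    u = v := by
  obtain ⟨H, -, hH⟩ := hK.regular p hp
  have h1 := hH _ ⟨u, ne_zero_of_norm_one hu, hun, rfl⟩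
  have h2 := hH _ ⟨v, ne_zero_of_norm_one hv, hvn, rfl⟩
  have h3 : p + quarterTurn u ∈ {y | ⟪v, y⟫ = ⟪v, p⟫} := by
    rw [h2, ← h1]
    simp only [Set.mem_ofPred_eq, inner_add_right, inner_quarterTurn]
    simp [planeDet]; ring
  simp only [Set.mem_ofPred_eq, inner_add_right, inner_quarterTurn] at h3
  obtain ⟨z, hz⟩ := hK.nonempty_interior
  refine unit_eq_of_planeDet_eq_zero (w := p - z) hu hv (by linarith) ?_ ?_
  · rw [inner_sub_right]
    linarith [hun.lt_of_mem_interior (ne_zero_of_norm_one hu) hz]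
  · rw [inner_sub_right]
    linarith [hvn.lt_of_mem_interior (ne_zero_of_norm_one hv) hz]

/-! ### Inscribed parallelograms -/

lemma isCounterclockwise_of_parallelogram {x : Plane} {p : Fin 4 → Plane} (h1 : p 1 = p 0 - x)
    (h2 : p 2 = p 3 - x) (h : 0 < planeDet x (p 0 - p 3)) : IsCounterclockwise p := by
  intro i j k hij hjk
  simp only [planeDet, PiLp.sub_apply] at h
  fin_cases i <;> fin_cases j <;> fin_cases k <;>
    first
    | (exfalso; revert hij hjk; decide)
    | (simp [planeDet, h1, h2]; linarith)

namespace IsInscribedParallelogram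

variable {x : Plane} {p u : Fin 4 → Plane}

lemma mem (hK : IsSmoothBody K) (H : IsInscribedParallelogram K x p u) (i : Fin 4) : p i ∈ K :=
  hK.frontier_subset (H.mem_frontier i)

lemma side_eq (H : IsInscribedParallelogram K x p u) : p 0 - p 3 = p 1 - p 2 := by
  have h1 := H.top_edge
  have h2 := H.bottom_edge
  rw [sub_eq_sub_iff_sub_eq_sub, ← h1, ← h2]

lemma planeDet_pos (H : IsInscribedParallelogram K x p u) : 0 < planeDet x (p 0 - p 3) := by
  have h := H.counterclockwise 0 1 2 (by decide) (by decide)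
  have h0 : x 0 = p 0 0 - p 1 0 := by rw [H.top_edge]; rfl
  have h1 : x 1 = p 0 1 - p 1 1 := by rw [H.top_edge]; rfl
  rw [H.side_eq]
  simp only [planeDet, PiLp.sub_apply] at h ⊢
  rw [h0, h1]; linarith

lemma ne_zero (H : IsInscribedParallelogram K x p u) : x ≠ 0 := by
  rintro rfl
  have := H.planeDet_pos
  simp [planeDet] at this

lemma side_ne_zero (H : IsInscribedParallelogram K x p u) : p 0 - p 3 ≠ 0 := by
  intro h
  have := H.planeDet_pos
  rw [h] at this
  simp [planeDet] at this

lemma inner_pos (hK : IsSmoothBody K) (H : IsInscribedParallelogram K x p u) {i j : Fin 4}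
    (hne : p j ≠ p i) : 0 < ⟪u i, p i - p j⟫ := by
  rw [inner_sub_right]
  linarith [(H.normal i).lt hK (H.norm_normal i) (H.mem hK i) (H.mem hK j) hne]

section signs

variable (hK : IsSmoothBody K) (H : IsInscribedParallelogram K x p u)
include hK H

lemma inner_zero_pos : 0 < ⟪u 0, x⟫ := by
  have : p 1 ≠ p 0 := fun h => H.ne_zero (by rw [H.top_edge, h, sub_self])
  have := H.inner_pos hK this
  rwa [← H.top_edge] at this

lemma inner_one_neg : ⟪u 1, x⟫ < 0 := by
  have : p 0 ≠ p 1 := fun h => H.ne_zero (by rw [H.top_edge, h, sub_self])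
  have := H.inner_pos hK this
  rw [← neg_sub, ← H.top_edge, inner_neg_right] at this
  linarith

lemma inner_two_neg : ⟪u 2, x⟫ < 0 := by
  have : p 3 ≠ p 2 := fun h => H.ne_zero (by rw [H.bottom_edge, h, sub_self])
  have := H.inner_pos hK this
  rw [← neg_sub, ← H.bottom_edge, inner_neg_right] at this
  linarith

lemma inner_three_pos : 0 < ⟪u 3, x⟫ := by
  have : p 2 ≠ p 3 := fun h => H.ne_zero (by rw [H.bottom_edge, h, sub_self])
  have := H.inner_pos hK this
  rwa [← H.bottom_edge] at this

lemma inner_zero_side_pos : 0 < ⟪u 0, p 0 - p 3⟫ :=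
  H.inner_pos hK fun h => H.side_ne_zero (by rw [h, sub_self])

lemma inner_one_side_pos : 0 < ⟪u 1, p 0 - p 3⟫ := by
  rw [H.side_eq]
  exact H.inner_pos hK fun h => H.side_ne_zero (by rw [H.side_eq, h, sub_self])

lemma inner_two_side_neg : ⟪u 2, p 0 - p 3⟫ < 0 := by
  have := H.inner_pos hK (i := 2) (j := 1)
    fun h => H.side_ne_zero (by rw [H.side_eq, h, sub_self])
  rw [← neg_sub, ← H.side_eq, inner_neg_right] at this
  linarith

lemma inner_three_side_neg : ⟪u 3, p 0 - p 3⟫ < 0 := by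
  have := H.inner_pos hK (i := 3) (j := 0) fun h => H.side_ne_zero (by rw [h, sub_self])
  rw [← neg_sub, inner_neg_right] at this
  linarith

lemma planeDet_zero_one_pos : 0 < planeDet (u 0) (u 1) := by
  have h := planeDet_mul_planeDet (u 0) (u 1) x (p 0 - p 3)
  have h1 := mul_pos (H.inner_zero_pos hK) (H.inner_one_side_pos hK)
  have h2 := mul_pos_of_neg_of_neg (neg_neg_of_pos (H.inner_zero_side_pos hK))
    (H.inner_one_neg hK)
  exact pos_of_mul_pos_left (by linarith) H.planeDet_pos.le

lemma planeDet_one_two_pos : 0 < planeDet (u 1) (u 2) := by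
  have h := planeDet_mul_planeDet (u 1) (u 2) x (p 0 - p 3)
  have h1 := mul_pos_of_neg_of_neg (H.inner_one_neg hK) (H.inner_two_side_neg hK)
  have h2 := mul_pos (H.inner_one_side_pos hK) (neg_pos.2 (H.inner_two_neg hK))
  exact pos_of_mul_pos_left (by linarith) H.planeDet_pos.le

lemma planeDet_two_three_pos : 0 < planeDet (u 2) (u 3) := by
  have h := planeDet_mul_planeDet (u 2) (u 3) x (p 0 - p 3)
  have h1 := mul_pos_of_neg_of_neg (H.inner_two_neg hK) (H.inner_three_side_neg hK)
  have h2 := mul_pos (neg_pos.2 (H.inner_two_side_neg hK)) (H.inner_three_pos hK)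
  exact pos_of_mul_pos_left (by linarith) H.planeDet_pos.le

/-- The upper edge of the inscribed parallelogram is the top of `K ∩ (K + x)` in the direction
perpendicular to `x`. -/
lemma planeDet_sub_zero_nonpos {w : Plane} (hw : w ∈ K) (hwx : w - x ∈ K) :
    planeDet x (w - p 0) ≤ 0 := by
  have h0 := H.normal 0 w hw
  have h1 := H.normal 1 _ hwx
  have e : p 1 = p 0 - x := by rw [H.top_edge]; abel
  rw [e, inner_sub_right, inner_sub_right] at h1
  have h0' : ⟪u 0, w - p 0⟫ ≤ 0 := by rw [inner_sub_right]; linarith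
  have h1' : ⟪u 1, w - p 0⟫ ≤ 0 := by rw [inner_sub_right]; linarith
  have h := planeDet_mul_planeDet (u 0) (u 1) x (w - p 0)
  have h2 := mul_nonneg (H.inner_zero_pos hK).le (neg_nonneg.2 h1')
  have h3 := mul_nonneg (neg_nonneg.2 h0') (neg_nonneg.2 (H.inner_one_neg hK).le)
  by_contra! hc
  have := mul_pos (H.planeDet_zero_one_pos hK) hc
  nlinarith

lemma planeDet_sub_three_nonneg {w : Plane} (hw : w ∈ K) (hwx : w - x ∈ K) :
    0 ≤ planeDet x (w - p 3) := by
  have h3 := H.normal 3 w hw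
  have h2 := H.normal 2 _ hwx
  have e : p 2 = p 3 - x := by rw [H.bottom_edge]; abel
  rw [e, inner_sub_right, inner_sub_right] at h2
  have h3' : ⟪u 3, w - p 3⟫ ≤ 0 := by rw [inner_sub_right]; linarith
  have h2' : ⟪u 2, w - p 3⟫ ≤ 0 := by rw [inner_sub_right]; linarith
  have h := planeDet_mul_planeDet (u 2) (u 3) x (w - p 3)
  have h4 := mul_nonneg (neg_nonneg.2 (H.inner_two_neg hK).le) (neg_nonneg.2 h3')
  have h5 := mul_nonneg (neg_nonneg.2 h2') (H.inner_three_pos hK).le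
  by_contra! hc
  have := mul_pos (H.planeDet_two_three_pos hK) (neg_pos.2 hc)
  nlinarith

/-- Two inscribed parallelograms with the same edge `x` have the same vertex `0`: both give the
extreme point of `K ∩ (K + x)` in the direction perpendicular to `x`. -/
lemma top_unique {q v : Fin 4 → Plane} (H' : IsInscribedParallelogram K x q v) : p 0 = q 0 := by
  have a1 := H.planeDet_sub_zero_nonpos hK (H'.mem hK 0)
    (by rw [show q 0 - x = q 1 by rw [H'.top_edge]; abel]; exact H'.mem hK 1)
  have h0 := H.normal 0 _ (H'.mem hK 0)
  have h1 := H.normal 1 _ (H'.mem hK 1)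
  have a2 := H'.planeDet_sub_zero_nonpos hK (H.mem hK 0)
    (by rw [show p 0 - x = p 1 by rw [H.top_edge]; abel]; exact H.mem hK 1)
  have e : planeDet x (q 0 - p 0) = 0 := by
    refine le_antisymm a1 ?_
    have : planeDet x (p 0 - q 0) = - planeDet x (q 0 - p 0) := by
      simp only [planeDet, PiLp.sub_apply]; ring
    linarith
  have e1 : p 1 = p 0 - x := by rw [H.top_edge]; abel
  have e2 : q 1 = q 0 - x := by rw [H'.top_edge]; abel
  rw [e1, e2, inner_sub_right, inner_sub_right] at h1
  have h0' : ⟪u 0, q 0 - p 0⟫ ≤ 0 := by rw [inner_sub_right]; linarith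
  have h1' : ⟪u 1, q 0 - p 0⟫ ≤ 0 := by rw [inner_sub_right]; linarith
  -- `q 0 - p 0` is a multiple of `x` on which both normals are nonpositive
  have hdet := planeDet_mul_planeDet (u 0) (u 1) x (q 0 - p 0)
  rw [e, mul_zero] at hdet
  have z0 : ⟪u 0, q 0 - p 0⟫ = 0 := by
    nlinarith [H.inner_zero_pos hK, H.inner_one_neg hK]
  have z1 : ⟪u 1, q 0 - p 0⟫ = 0 := by
    rw [z0] at hdet
    have := (H.inner_zero_pos hK).ne'
    simpa [this] using hdet.symm
  have := planeDet_smul_eq (u 0) (u 1) (q 0 - p 0)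
  rw [z0, z1, zero_smul, zero_smul, sub_zero] at this
  rcases smul_eq_zero.1 this with h | h
  · exact absurd h (H.planeDet_zero_one_pos hK).ne'
  · exact (sub_eq_zero.1 h).symm

end signs

end IsInscribedParallelogram

/-- The half turn exchanges a body with its point reflection and shifts the vertices of an
inscribed parallelogram by two places. -/
lemma IsInscribedParallelogram.neg {x : Plane} {p u : Fin 4 → Plane}
    (H : IsInscribedParallelogram K x p u) :
    IsInscribedParallelogram (-K) x (fun i => -p (i + 2)) (fun i => -u (i + 2)) where
  mem_frontier i := by
    have : frontier (-K) = -frontier K := by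
      have := (Homeomorph.neg Plane).preimage_frontier K
      simpa using this.symm
    rw [this]; simpa using H.mem_frontier (i + 2)
  counterclockwise := by
    apply isCounterclockwise_of_parallelogram (x := x)
    · simp only [show (0 : Fin 4) + 2 = 2 from rfl, show (1 : Fin 4) + 2 = 3 from rfl]
      rw [H.bottom_edge]; abel
    · simp only [show (2 : Fin 4) + 2 = 0 from rfl, show (3 : Fin 4) + 2 = 1 from rfl]
      rw [H.top_edge]; abel
    · simp only [show (0 : Fin 4) + 2 = 2 from rfl, show (3 : Fin 4) + 2 = 1 from rfl]
      rw [neg_sub_neg, ← H.side_eq]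
      exact H.planeDet_pos
  top_edge := by
    simp only [show (0 : Fin 4) + 2 = 2 from rfl, show (1 : Fin 4) + 2 = 3 from rfl]
    rw [H.bottom_edge]; abel
  bottom_edge := by
    simp only [show (2 : Fin 4) + 2 = 0 from rfl, show (3 : Fin 4) + 2 = 1 from rfl]
    rw [H.top_edge]; abel
  norm_normal i := by rw [norm_neg]; exact H.norm_normal _
  normal i := by
    intro y hy
    have := H.normal (i + 2) (-y) hy
    simpa using this

namespace IsSmoothBody

lemma neg (hK : IsSmoothBody K) : IsSmoothBody (-K) where
  compact := hK.compact.neg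
  convex := hK.convex.neg
  nonempty_interior := by
    have : interior (-K) = -interior K := by
      have := (Homeomorph.neg Plane).preimage_interior K
      simpa using this.symm
    rw [this]; exact hK.nonempty_interior.neg
  strictConvex := hK.strictConvex.neg
  regular := by
    intro p hp
    have hf : frontier (-K) = -frontier K := by
      have := (Homeomorph.neg Plane).preimage_frontier K
      simpa using this.symm
    rw [hf] at hp
    have key : ∀ (M : Set Plane) (q : Plane) (H : Set Plane),
        IsSupportingLine M q H → IsSupportingLine (-M) (-q) (-H) := by
      rintro M q H ⟨u, hu, hn, rfl⟩
      refine ⟨-u, neg_ne_zero.2 hu, fun y hy => by simpa using hn (-y) hy, ?_⟩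
      ext y
      simp [neg_eq_iff_eq_neg]
    obtain ⟨H, hH, hHu⟩ := hK.regular (-p) hp
    refine ⟨-H, by simpa using key _ _ _ hH, fun H' hH' => ?_⟩
    have := hHu (-H') (by simpa using key _ _ _ hH')
    rw [← this, neg_neg]

/-- An inscribed parallelogram with given edge is determined by the body and the edge. -/
lemma inscribed_unique (hK : IsSmoothBody K) {x : Plane} {p u q v : Fin 4 → Plane}
    (H : IsInscribedParallelogram K x p u) (H' : IsInscribedParallelogram K x q v) :
    p = q ∧ u = v := by
  have h0 := H.top_unique hK H'
  have h2 := H.neg.top_unique hK.neg H'.neg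
  simp only [show (0 : Fin 4) + 2 = 2 from rfl, neg_inj] at h2
  have h1 : p 1 = q 1 := by
    have := H.top_edge.symm.trans H'.top_edge
    rw [h0] at this; simpa using this
  have h3 : p 3 = q 3 := by
    have := H.bottom_edge.symm.trans H'.bottom_edge
    rw [h2] at this; simpa using this
  have hp : p = q := by
    ext1 i; fin_cases i <;> assumption
  refine ⟨hp, ?_⟩
  subst hp
  ext1 i
  exact hK.normal_unique (H.mem_frontier i) (H.norm_normal i) (H.normal i) (H'.norm_normal i)
    (H'.normal i)

end IsSmoothBody

/-- The nonzero vectors `x` for which the interiors of `K` and `K + x` meet. -/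
def overlapDomain (K : Set Plane) : Set Plane :=
  {x | x ≠ 0 ∧ ∃ z ∈ interior K, z - x ∈ interior K}

lemma planeDet_const_continuous (x : Plane) : Continuous (planeDet x) := by
  unfold planeDet; fun_prop

/-- A point of `K ∩ (K + x)` that is extreme in the direction perpendicular to `x` lies on both
boundaries: otherwise it would be the unique extreme point of `K` or `K + x`. -/
lemma IsSmoothBody.frontier_of_isMax (hK : IsSmoothBody K) {x p c : Plane} (hx : x ≠ 0)
    (hp : p ∈ K) (hpx : p - x ∈ K) (hc : ∀ y, ⟪c, y⟫ = planeDet x y ∨ ⟪c, y⟫ = -planeDet x y)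
    (hmax : ∀ w ∈ K, w - x ∈ K → ⟪c, w⟫ ≤ ⟪c, p⟫) :
    p ∈ frontier K ∧ p - x ∈ frontier K := by
  have hcx : ⟪c, x⟫ = 0 := by
    rcases hc x with h | h <;> rw [h] <;> simp [planeDet] <;> ring
  have hc0 : c ≠ 0 := by
    rintro rfl
    have h := hc (quarterTurn x)
    have hs : x 0 ^ 2 + x 1 ^ 2 = 0 := by
      simp only [inner_zero_left, planeDet, quarterTurn_zero_coord, quarterTurn_one_coord] at h
      rcases h with h | h <;> linarith
    have h0 : x 0 ^ 2 = 0 := by linarith [sq_nonneg (x 0), sq_nonneg (x 1)]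
    have h1 : x 1 ^ 2 = 0 := by linarith [sq_nonneg (x 0), sq_nonneg (x 1)]
    exact hx (plane_ext (by simpa using h0) (by simpa using h1))
  -- a local maximum of a linear functional on a convex set is a strict global one
  have glob : ∀ a b : Plane, a ∈ K → b ∈ K → a ≠ b → a - b = x ∨ b - a = x →
      (∀ᶠ t in nhdsWithin (0 : ℝ) (Set.Ioi 0), ∀ w ∈ K, ⟪c, (1 - t) • a + t • w⟫ ≤ ⟪c, a⟫) →
      False := by
    intro a b ha hb hab hx' hev
    have hn : IsOuterNormal K a c := by
      intro w hw
      obtain ⟨t, ht, ht0⟩ := (hev.and self_mem_nhdsWithin).exists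
      have := ht w hw
      have ht0 : 0 < t := ht0
      rw [inner_add_right, inner_smul_right, inner_smul_right] at this
      nlinarith
    have hm := hK.strictConvex ha hb hab (a := 1/2) (b := 1/2) (by norm_num) (by norm_num)
      (by norm_num)
    have := hn.lt_of_mem_interior hc0 hm
    rw [inner_add_right, inner_smul_right, inner_smul_right] at this
    have e : ⟪c, a⟫ = ⟪c, b⟫ := by
      rcases hx' with h | h <;> rw [← h, inner_sub_right] at hcx <;> linarith
    rw [e] at this; linarith
  have hcomb : ∀ a w : Plane, a ∈ K → w ∈ K → ∀ t : ℝ, 0 < t → t < 1 → (1 - t) • a + t • w ∈ K :=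
    fun a w ha hw t h0 h1 => hK.convex ha hw (by linarith) h0.le (by ring)
  obtain ⟨R, hR⟩ := hK.compact.isBounded.exists_norm_le
  have hnear : ∀ a ∈ K, ∀ y ∈ interior K, ∀ᶠ t in nhdsWithin (0 : ℝ) (Set.Ioi 0),
      ∀ w ∈ K, y + t • (w - a) ∈ K := by
    intro a ha y hy
    obtain ⟨ε, hε, hball⟩ := Metric.isOpen_iff.1 isOpen_interior y hy
    have hR0 : 0 ≤ R := (norm_nonneg _).trans (hR a ha)
    have : Set.Ioo (0 : ℝ) (ε / (2 * R + 1)) ∈ nhdsWithin (0 : ℝ) (Set.Ioi 0) :=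
      Ioo_mem_nhdsGT (by positivity)
    filter_upwards [this] with t ht w hw
    refine interior_subset (hball ?_)
    rw [mem_ball_iff_norm, add_sub_cancel_left, norm_smul, Real.norm_eq_abs, abs_of_pos ht.1]
    have h1 : ‖w - a‖ ≤ 2 * R := (norm_sub_le _ _).trans (by linarith [hR a ha, hR w hw])
    have h2 := (lt_div_iff₀ (by positivity)).1 ht.2
    nlinarith [ht.1, norm_nonneg (w - a)]
  have hlt : ∀ᶠ t in nhdsWithin (0 : ℝ) (Set.Ioi 0), t ∈ Set.Ioo (0 : ℝ) 1 :=
    Ioo_mem_nhdsGT one_pos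
  have hne : p ≠ p - x := fun h => hx (by simpa using sub_eq_self.1 h.symm)
  constructor
  · refine ⟨subset_closure hp, fun hi => ?_⟩
    refine glob (p - x) p hpx hp hne.symm (Or.inr (by abel)) ?_
    filter_upwards [hnear (p - x) hpx p hi, hlt] with t ht ht1 w hw
    have h1 := hmax _ (ht w hw) (by
      have := hcomb _ w hpx hw t ht1.1 ht1.2
      convert this using 1; module)
    rw [inner_add_right] at h1
    rw [show (1 - t) • (p - x) + t • w = (p - x) + t • (w - (p - x)) by module, inner_add_right]
    linarith
  · refine ⟨subset_closure hpx, fun hi => ?_⟩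
    refine glob p (p - x) hp hpx hne (Or.inl (by abel)) ?_
    filter_upwards [hnear p hp (p - x) hi, hlt] with t ht ht1 w hw
    have h1 := hmax _ (hcomb _ w hp hw t ht1.1 ht1.2) (by
      have := ht w hw
      convert this using 1; module)
    exact h1

/-- The vertices `0` and `3` are the extreme points of `K ∩ (K + x)` in the two directions
perpendicular to `x`. -/
lemma IsSmoothBody.exists_inscribed (hK : IsSmoothBody K) {x : Plane} (hx : x ∈ overlapDomain K) :
    ∃ p u : Fin 4 → Plane, IsInscribedParallelogram K x p u := by
  obtain ⟨hx0, z, hz, hzx⟩ := hx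
  set Q : Set Plane := K ∩ (fun w => w - x) ⁻¹' K with hQ
  have hQc : IsCompact Q :=
    hK.compact.inter_right (hK.compact.isClosed.preimage (by fun_prop))
  have hzQ : z ∈ interior Q := by
    have h : interior K ∩ (fun w => w - x) ⁻¹' interior K ⊆ interior Q := by
      apply interior_maximal
      · exact Set.inter_subset_inter interior_subset (Set.preimage_mono interior_subset)
      · exact isOpen_interior.inter (isOpen_interior.preimage (by fun_prop))
    exact h ⟨hz, hzx⟩
  have hzQ' : z ∈ Q := interior_subset hzQ
  have hJ0 : quarterTurn x ≠ 0 := by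
    rw [← norm_ne_zero_iff, norm_quarterTurn]; exact norm_ne_zero_iff.2 hx0
  have hJ : ∀ y, ⟪quarterTurn x, y⟫ = planeDet x y := fun y => by
    rw [real_inner_comm, inner_quarterTurn]
  have hJn : ∀ y, ⟪-quarterTurn x, y⟫ = -planeDet x y := fun y => by
    rw [inner_neg_left, hJ]
  obtain ⟨a, ha, hamax⟩ := hQc.exists_isMaxOn ⟨z, hzQ'⟩
    (f := fun y => ⟪quarterTurn x, y⟫) (by fun_prop)
  obtain ⟨b, hb, hbmax⟩ := hQc.exists_isMaxOn ⟨z, hzQ'⟩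
    (f := fun y => ⟪-quarterTurn x, y⟫) (by fun_prop)
  have hfa := hK.frontier_of_isMax hx0 ha.1 ha.2 (fun y => Or.inl (hJ y))
    (fun w hw hwx => hamax (show w ∈ Q from ⟨hw, hwx⟩))
  have hfb := hK.frontier_of_isMax hx0 hb.1 hb.2 (fun y => Or.inr (hJn y))
    (fun w hw hwx => hbmax (show w ∈ Q from ⟨hw, hwx⟩))
  have hlt : planeDet x b < planeDet x a := by
    obtain ⟨y, hy, hzy⟩ := exists_gt_of_mem_interior hzQ hJ0
    obtain ⟨y', hy', hzy'⟩ := exists_gt_of_mem_interior hzQ (neg_ne_zero.2 hJ0)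
    have h1 := hamax hy
    have h2 := hbmax hy'
    simp only [Set.mem_ofPred_eq, hJ, hJn] at h1 h2 hzy hzy'
    linarith
  have hfr : ∀ i : Fin 4, (![a, a - x, b - x, b] : Fin 4 → Plane) i ∈ frontier K := by
    intro i; fin_cases i
    exacts [hfa.1, hfa.2, hfb.2, hfb.1]
  choose u hu hun using fun i => hK.exists_normal (hfr i)
  refine ⟨_, u, hfr, isCounterclockwise_of_parallelogram (x := x) (by simp) (by simp) ?_,
    by simp, by simp, hu, hun⟩
  simp only [planeDet] at hlt
  simp [planeDet]; linarith

/-! ### Continuity of the inscribed parallelogram -/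

/-- The vertices and the normals of the inscribed parallelogram with edge `x`, a junk value
if there is none. -/
def inscribedData (K : Set Plane) (x : Plane) : (Fin 4 → Plane) × (Fin 4 → Plane) :=
  Classical.epsilon fun d => IsInscribedParallelogram K x d.1 d.2

/-- The vertices of the inscribed parallelogram with edge `x`. -/
def vert (K : Set Plane) (x : Plane) : Fin 4 → Plane := (inscribedData K x).1

/-- The outer unit normals at the vertices of the inscribed parallelogram with edge `x`. -/
def nrm (K : Set Plane) (x : Plane) : Fin 4 → Plane := (inscribedData K x).2

/-- The edge from the vertex `3` to the vertex `0` of the inscribed parallelogram with edge `x`; as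
a function of `x` it is called the edge map. -/
def side (K : Set Plane) (x : Plane) : Plane := vert K x 0 - vert K x 3

lemma IsSmoothBody.inscribed (hK : IsSmoothBody K) {x : Plane} (hx : x ∈ overlapDomain K) :
    IsInscribedParallelogram K x (vert K x) (nrm K x) := by
  obtain ⟨p, u, h⟩ := hK.exists_inscribed hx
  exact Classical.epsilon_spec (p := fun d : (Fin 4 → Plane) × (Fin 4 → Plane) =>
    IsInscribedParallelogram K x d.1 d.2) ⟨(p, u), h⟩

lemma IsInscribedParallelogram.mem_overlapDomain (hK : IsSmoothBody K) {x : Plane}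
    {p u : Fin 4 → Plane} (H : IsInscribedParallelogram K x p u) :
    x ∈ overlapDomain K := by
  have h1 : p 0 ≠ p 3 := fun h => H.side_ne_zero (by rw [h, sub_self])
  have h2 : p 1 ≠ p 2 := fun h => H.side_ne_zero (by rw [H.side_eq, h, sub_self])
  have m1 := hK.strictConvex (H.mem hK 0) (H.mem hK 3) h1 (a := 1/2) (b := 1/2) (by norm_num)
    (by norm_num) (by norm_num)
  have m2 := hK.strictConvex (H.mem hK 1) (H.mem hK 2) h2 (a := 1/2) (b := 1/2) (by norm_num)
    (by norm_num) (by norm_num)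
  refine ⟨H.ne_zero, _, m1, ?_⟩
  convert m2 using 1
  have e1 : p 1 = p 0 - x := by rw [H.top_edge]; abel
  have e2 : p 2 = p 3 - x := by rw [H.bottom_edge]; abel
  rw [e1, e2]; module

lemma isOpen_overlapDomain (K : Set Plane) : IsOpen (overlapDomain K) := by
  have : overlapDomain K = {0}ᶜ ∩ (interior K - interior K) := by
    ext x
    simp only [overlapDomain, Set.mem_ofPred_eq, Set.mem_inter_iff, Set.mem_compl_iff,
      Set.mem_singleton_iff, Set.mem_sub]
    refine and_congr_right fun _ => ⟨?_, ?_⟩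
    · rintro ⟨z, h1, h2⟩
      exact ⟨z, h1, z - x, h2, sub_sub_cancel z x⟩
    · rintro ⟨z, h1, w, h2, rfl⟩
      exact ⟨z, h1, by simpa using h2⟩
  rw [this]
  exact isOpen_compl_singleton.inter isOpen_interior.sub_right

/-- Near a vector `x₀` for which the interiors of `K` and `K + x₀` meet, the height of the inscribed
parallelogram is bounded from below. -/
lemma IsSmoothBody.eventually_height_ge (hK : IsSmoothBody K) {x₀ z : Plane}
    (hz : z ∈ interior K) (hzx : z - x₀ ∈ interior K) :
    ∃ r > 0, ∀ᶠ y in nhds x₀, y ∈ overlapDomain K → r * ‖y‖ ≤ planeDet y (side K y) := by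
  obtain ⟨ε₁, hε₁, h1⟩ := Metric.isOpen_iff.1 isOpen_interior z hz
  obtain ⟨ε₂, hε₂, h2⟩ := Metric.isOpen_iff.1 isOpen_interior _ hzx
  set ε := min ε₁ ε₂ with hε
  have hε0 : 0 < ε := lt_min hε₁ hε₂
  refine ⟨ε, hε0, ?_⟩
  filter_upwards [Metric.ball_mem_nhds x₀ (half_pos hε0)] with y hy hyO
  have H := hK.inscribed hyO
  have hy0 : 0 < ‖y‖ := norm_pos_iff.2 H.ne_zero
  set n : Plane := (ε / 2 * ‖y‖⁻¹) • quarterTurn y with hn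
  have hnn : ‖n‖ = ε / 2 := by
    rw [hn, norm_smul, norm_quarterTurn, Real.norm_eq_abs, abs_of_pos (by positivity)]
    field_simp
  rw [mem_ball_iff_norm] at hy
  have key : ∀ m : Plane, ‖m‖ = ε / 2 → z + m ∈ K ∧ z + m - y ∈ K := by
    intro m hm
    constructor
    · apply interior_subset; apply h1
      rw [mem_ball_iff_norm, add_sub_cancel_left, hm]
      linarith [min_le_left ε₁ ε₂]
    · apply interior_subset; apply h2
      rw [mem_ball_iff_norm]
      calc ‖z + m - y - (z - x₀)‖ = ‖m - (y - x₀)‖ := by congr 1; abel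
        _ ≤ ‖m‖ + ‖y - x₀‖ := norm_sub_le _ _
        _ < ε₂ := by linarith [min_le_right ε₁ ε₂]
  obtain ⟨a1, a2⟩ := key n hnn
  obtain ⟨b1, b2⟩ := key (-n) (by rw [norm_neg, hnn])
  have c1 := H.planeDet_sub_zero_nonpos hK a1 a2
  have c2 := H.planeDet_sub_three_nonneg hK b1 b2
  have hyy : y 0 ^ 2 + y 1 ^ 2 = ‖y‖ ^ 2 := by
    rw [EuclideanSpace.norm_sq_eq]; simp [Fin.sum_univ_two]
  have c3 : planeDet y n = ε / 2 * ‖y‖ := by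
    have : planeDet y n = (ε / 2 * ‖y‖⁻¹) * (y 0 ^ 2 + y 1 ^ 2) := by
      simp only [planeDet, hn, PiLp.smul_apply, smul_eq_mul, quarterTurn_zero_coord,
        quarterTurn_one_coord]
      ring
    rw [this, hyy]; field_simp
  simp only [planeDet, side, PiLp.add_apply, PiLp.sub_apply, PiLp.neg_apply] at c1 c2 c3 ⊢
  linarith

/-- Along an ultrafilter, vertices and normals of inscribed parallelograms converge to boundary
points and normals, although the limit parallelogram may be degenerate. -/
lemma IsSmoothBody.exists_limit (hK : IsSmoothBody K) {U : Ultrafilter Plane} {x₀ : Plane}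
    (hU : (U : Filter Plane) ≤ nhds x₀) (hO : overlapDomain K ∈ U) :
    ∃ p u : Fin 4 → Plane,
      (∀ i, Filter.Tendsto (fun y => vert K y i) U (nhds (p i))) ∧
      (∀ i, Filter.Tendsto (fun y => nrm K y i) U (nhds (u i))) ∧
      (∀ i, p i ∈ frontier K) ∧ (∀ i, ‖u i‖ = 1) ∧ (∀ i, IsOuterNormal K (p i) (u i)) ∧
      x₀ = p 0 - p 1 ∧ x₀ = p 3 - p 2 := by
  have hfc : IsCompact (frontier K) := hK.compact.of_isClosed_subset isClosed_frontier
    hK.frontier_subset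
  have hin : ∀ᶠ y in (U : Filter Plane),
      IsInscribedParallelogram K y (vert K y) (nrm K y) := by
    filter_upwards [hO] with y hy using hK.inscribed hy
  have hp : ∀ i, ∃ a ∈ frontier K, Filter.Tendsto (fun y => vert K y i) U (nhds a) := by
    intro i
    have : frontier K ∈ Filter.map (fun y => vert K y i) U :=
      Filter.mem_map.2 (hin.mono fun y hy => hy.mem_frontier i)
    exact hfc.ultrafilter_le_nhds (U.map _) (Filter.le_principal_iff.2 this)
  have hu : ∀ i, ∃ a ∈ Metric.sphere (0 : Plane) 1,
      Filter.Tendsto (fun y => nrm K y i) U (nhds a) := by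
    intro i
    have : Metric.sphere (0 : Plane) 1 ∈ Filter.map (fun y => nrm K y i) U :=
      Filter.mem_map.2 (hin.mono fun y hy => by simpa using hy.norm_normal i)
    exact (isCompact_sphere (0 : Plane) 1).ultrafilter_le_nhds (U.map _) (Filter.le_principal_iff.2 this)
  choose p hpf hpt using hp
  choose u huf hut using hu
  have hid : Filter.Tendsto (fun y : Plane => y) U (nhds x₀) := hU
  refine ⟨p, u, hpt, hut, hpf, fun i => by simpa using huf i, fun i w hw => ?_, ?_, ?_⟩
  · refine le_of_tendsto_of_tendsto ((hut i).inner tendsto_const_nhds) ((hut i).inner (hpt i)) ?_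
    filter_upwards [hin] with y hy using hy.normal i w hw
  · refine tendsto_nhds_unique hid (((hpt 0).sub (hpt 1)).congr' ?_)
    filter_upwards [hin] with y hy using hy.top_edge.symm
  · refine tendsto_nhds_unique hid (((hpt 3).sub (hpt 2)).congr' ?_)
    filter_upwards [hin] with y hy using hy.bottom_edge.symm

lemma Filter.Tendsto.planeDet {α : Type*} {l : Filter α} {f g : α → Plane} {a b : Plane}
    (hf : Filter.Tendsto f l (nhds a)) (hg : Filter.Tendsto g l (nhds b)) :
    Filter.Tendsto (fun y => _root_.planeDet (f y) (g y)) l (nhds (_root_.planeDet a b)) := by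
  have hc : Continuous fun z : Plane × Plane => _root_.planeDet z.1 z.2 := by
    unfold _root_.planeDet; fun_prop
  exact (hc.tendsto (a, b)).comp (hf.prodMk_nhds hg)

/-- Any limit of inscribed parallelograms is again inscribed, as its height stays positive, so
continuity follows from uniqueness and compactness. -/
lemma IsSmoothBody.continuousAt_data (hK : IsSmoothBody K) {x : Plane} (hx : x ∈ overlapDomain K)
    (i : Fin 4) : ContinuousAt (fun y => vert K y i) x ∧ ContinuousAt (fun y => nrm K y i) x := by
  have hON : overlapDomain K ∈ nhds x := (isOpen_overlapDomain K).mem_nhds hx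
  have key : ∀ U : Ultrafilter Plane, (U : Filter Plane) ≤ nhds x →
      Filter.Tendsto (fun y => vert K y i) U (nhds (vert K x i)) ∧
      Filter.Tendsto (fun y => nrm K y i) U (nhds (nrm K x i)) := by
    intro U hU
    obtain ⟨p, u, hpt, hut, hpf, hu, hn, e1, e2⟩ := hK.exists_limit hU (hU hON)
    obtain ⟨hx0, z, hz, hzx⟩ := hx
    obtain ⟨r, hr, hev⟩ := hK.eventually_height_ge hz hzx
    have hid : Filter.Tendsto (fun y : Plane => y) U (nhds x) := hU
    have hdet : r * ‖x‖ ≤ planeDet x (p 0 - p 3) := by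
      refine le_of_tendsto_of_tendsto (hid.norm.const_mul r)
        (hid.planeDet ((hpt 0).sub (hpt 3))) ?_
      filter_upwards [hU hev, hU hON] with y hy hyO using hy hyO
    have hpos : 0 < planeDet x (p 0 - p 3) :=
      (mul_pos hr (norm_pos_iff.2 hx0)).trans_le hdet
    have H : IsInscribedParallelogram K x p u :=
      ⟨hpf, isCounterclockwise_of_parallelogram (by rw [e1]; abel) (by rw [e2]; abel) hpos,
        e1, e2, hu, hn⟩
    obtain ⟨rfl, rfl⟩ := hK.inscribed_unique (hK.inscribed ⟨hx0, z, hz, hzx⟩) H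
    exact ⟨hpt i, hut i⟩
  exact ⟨Filter.tendsto_iff_ultrafilter _ _ _ |>.2 fun U hU => (key U hU).1,
    Filter.tendsto_iff_ultrafilter _ _ _ |>.2 fun U hU => (key U hU).2⟩

lemma IsSmoothBody.continuousAt_vert (hK : IsSmoothBody K) {x : Plane}
    (hx : x ∈ overlapDomain K) (i : Fin 4) : ContinuousAt (fun y => vert K y i) x :=
  (hK.continuousAt_data hx i).1

lemma IsSmoothBody.continuousAt_nrm (hK : IsSmoothBody K) {x : Plane}
    (hx : x ∈ overlapDomain K) (i : Fin 4) : ContinuousAt (fun y => nrm K y i) x :=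
  (hK.continuousAt_data hx i).2

/-! ### Degeneration at the boundary of the domain -/

/-- When the edge tends to `0`, the upper right normal becomes perpendicular to its direction. -/
lemma IsSmoothBody.limit_nrm_of_tendsto_zero (hK : IsSmoothBody K) {U : Ultrafilter Plane}
    (hU : (U : Filter Plane) ≤ nhds 0) (hO : overlapDomain K ∈ U) {e : Plane}
    (he : Filter.Tendsto (fun y : Plane => ‖y‖⁻¹ • y) U (nhds e)) :
    Filter.Tendsto (fun y => nrm K y 0) U (nhds (quarterTurn e)) := by
  obtain ⟨p, u, hpt, hut, hpf, hu, hn, e1, e2⟩ := hK.exists_limit hU hO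
  obtain ⟨z, hz⟩ := hK.nonempty_interior
  obtain ⟨r, hr, hev⟩ := hK.eventually_height_ge (x₀ := 0) hz (by simpa using hz)
  have hin : ∀ᶠ y in (U : Filter Plane),
      IsInscribedParallelogram K y (vert K y) (nrm K y) := by
    filter_upwards [hO] with y hy using hK.inscribed hy
  have hne : ‖e‖ = 1 := by
    refine tendsto_nhds_unique he.norm (tendsto_const_nhds.congr' ?_)
    filter_upwards [hin] with y hy
    exact (norm_smul_inv_norm (𝕜 := ℝ) hy.ne_zero).symm
  have hdet : r ≤ planeDet e (p 0 - p 3) := by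
    refine ge_of_tendsto (he.planeDet ((hpt 0).sub (hpt 3))) ?_
    filter_upwards [hU hev, hin, hO] with y h1 hy hyO
    have hy0 : 0 < ‖y‖ := norm_pos_iff.2 hy.ne_zero
    have h2 := h1 hyO
    have h3 : planeDet (‖y‖⁻¹ • y) (side K y) = ‖y‖⁻¹ * planeDet y (side K y) := by
      simp only [planeDet, PiLp.smul_apply, smul_eq_mul]; ring
    change r ≤ planeDet (‖y‖⁻¹ • y) (side K y)
    rw [h3, inv_mul_eq_div, le_div_iff₀ hy0]
    exact h2
  have hp01 : p 0 = p 1 := (sub_eq_zero.1 e1.symm)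
  have hu01 : u 0 = u 1 := by
    refine hK.normal_unique (hpf 0) (hu 0) (hn 0) (hu 1) ?_
    rw [hp01]; exact hn 1
  have h0 : 0 ≤ ⟪u 0, e⟫ := by
    refine ge_of_tendsto ((hut 0).inner he) ?_
    filter_upwards [hin] with y hy
    rw [inner_smul_right]
    exact mul_nonneg (by positivity) (hy.inner_zero_pos hK).le
  have h1 : ⟪u 1, e⟫ ≤ 0 := by
    refine le_of_tendsto ((hut 1).inner he) ?_
    filter_upwards [hin] with y hy
    rw [inner_smul_right]
    exact mul_nonpos_of_nonneg_of_nonpos (by positivity) (hy.inner_one_neg hK).le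
  have h2 : 0 ≤ ⟪u 0, p 0 - p 3⟫ := by
    refine ge_of_tendsto ((hut 0).inner ((hpt 0).sub (hpt 3))) ?_
    filter_upwards [hin] with y hy using (hy.inner_zero_side_pos hK).le
  have h3 : ⟪u 0, e⟫ = 0 := le_antisymm (hu01 ▸ h1) h0
  have hpar : planeDet (u 0) (quarterTurn e) = 0 := by
    rw [← h3]; simp [planeDet, plane_inner_eq]
  -- `u 0` is one of the two unit vectors perpendicular to `e`; the side `p 0 - p 3` decides
  have hpos : 0 < ⟪quarterTurn e, p 0 - p 3⟫ := by
    rw [real_inner_comm, inner_quarterTurn]; linarith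
  have hcoef := planeDet_smul_eq e (quarterTurn e) (u 0)
  have hee := unit_coord hne
  have hd1 : planeDet e (quarterTurn e) = 1 := by
    simp only [planeDet, quarterTurn_zero_coord, quarterTurn_one_coord]; linarith
  have hes : ⟪e, u 0⟫ = 0 := by rw [real_inner_comm]; exact h3
  rw [hd1, one_smul, hes, zero_smul, sub_zero] at hcoef
  have hupos : 0 < ⟪u 0, p 0 - p 3⟫ := by
    refine lt_of_le_of_ne h2 fun h => ?_
    rw [hcoef, inner_smul_left] at h
    simp only [conj_trivial] at h
    rcases mul_eq_zero.1 h.symm with h | h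
    · rw [h, zero_smul] at hcoef
      exact ne_zero_of_norm_one (hu 0) hcoef
    · exact hpos.ne' h
  have := unit_eq_of_planeDet_eq_zero (hu 0) (by rw [norm_quarterTurn, hne]) hpar hupos hpos
  rw [← this]
  exact hut 0

lemma IsSmoothBody.inner_le_of_interior_sub (hK : IsSmoothBody K) {w : Plane} {c : ℝ}
    (h : ∀ y ∈ interior K - interior K, ⟪w, y⟫ ≤ c) {y : Plane} (hy : y ∈ K - K) : ⟪w, y⟫ ≤ c := by
  obtain ⟨a, ha, b, hb, rfl⟩ := hy
  rw [← hK.closure_interior] at ha hb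
  have hcl : IsClosed {q : Plane × Plane | ⟪w, q.1 - q.2⟫ ≤ c} :=
    isClosed_le (by fun_prop) continuous_const
  have hsub : interior K ×ˢ interior K ⊆ {q : Plane × Plane | ⟪w, q.1 - q.2⟫ ≤ c} := by
    rintro ⟨a, b⟩ ⟨ha, hb⟩
    exact h _ (Set.sub_mem_sub ha hb)
  have := closure_minimal hsub hcl
  rw [closure_prod_eq] at this
  exact this (Set.mk_mem_prod ha hb)

/-- When the edge tends to a boundary point of `K - K`, the upper right normal tends to the normal
of `K - K`. -/
lemma IsSmoothBody.limit_nrm_of_support (hK : IsSmoothBody K) {U : Ultrafilter Plane} {x₀ w : Plane}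
    (hU : (U : Filter Plane) ≤ nhds x₀) (hO : overlapDomain K ∈ U) (hw : w ≠ 0)
    (hsup : ∀ y ∈ interior K - interior K, ⟪w, y⟫ ≤ ⟪w, x₀⟫) :
    Filter.Tendsto (fun y => nrm K y 0) U (nhds (‖w‖⁻¹ • w)) := by
  obtain ⟨p, u, hpt, hut, hpf, hu, hn, e1, e2⟩ := hK.exists_limit hU hO
  have hnw : IsOuterNormal K (p 0) (‖w‖⁻¹ • w) := by
    intro y hy
    have := hK.inner_le_of_interior_sub hsup (Set.sub_mem_sub hy (hK.frontier_subset (hpf 1)))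
    rw [e1, inner_sub_right, inner_sub_right] at this
    simp only [inner_smul_left, conj_trivial]
    exact mul_le_mul_of_nonneg_left (by linarith) (by positivity)
  have h1 : ‖‖w‖⁻¹ • w‖ = 1 := norm_smul_inv_norm (𝕜 := ℝ) hw
  rw [← hK.normal_unique (hpf 0) (hu 0) (hn 0) h1 hnw]
  exact hut 0

/-- The normals of two bodies with the same difference body agree in the limit at the boundary of
their common domain. -/
lemma tendsto_inner_nrm_one (hK : IsSmoothBody K) (hL : IsSmoothBody L)
    (hKL : interior K - interior K = interior L - interior L) {U : Ultrafilter Plane} {x₀ : Plane}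
    (hU : (U : Filter Plane) ≤ nhds x₀) (hKO : overlapDomain K ∈ U) (hLO : overlapDomain L ∈ U)
    (hx₀ : x₀ ∉ overlapDomain K) :
    Filter.Tendsto (fun y => ⟪nrm K y 0, nrm L y 0⟫) U (nhds 1) := by
  have fin : ∀ n : Plane, ‖n‖ = 1 → Filter.Tendsto (fun y => nrm K y 0) U (nhds n) →
      Filter.Tendsto (fun y => nrm L y 0) U (nhds n) →
      Filter.Tendsto (fun y => ⟪nrm K y 0, nrm L y 0⟫) U (nhds 1) := by
    intro n hn h1 h2
    have := h1.inner (𝕜 := ℝ) h2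
    rwa [real_inner_self_eq_norm_sq, hn, one_pow] at this
  by_cases h0 : x₀ = 0
  · subst h0
    have hs : Metric.sphere (0 : Plane) 1 ∈ Filter.map (fun y => ‖y‖⁻¹ • y) U := by
      refine Filter.mem_map.2 (Filter.mem_of_superset hKO fun y hy => ?_)
      simpa using norm_smul_inv_norm (𝕜 := ℝ) hy.1
    obtain ⟨e, he, het⟩ := (isCompact_sphere (0 : Plane) 1).ultrafilter_le_nhds (U.map _)
      (Filter.le_principal_iff.2 hs)
    exact fin _ (by rw [norm_quarterTurn]; simpa using he)
      (hK.limit_nrm_of_tendsto_zero hU hKO het) (hL.limit_nrm_of_tendsto_zero hU hLO het)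
  · have hx : x₀ ∉ interior K - interior K := by
      rintro ⟨a, ha, b, hb, rfl⟩
      exact hx₀ ⟨h0, a, ha, by simpa using hb⟩
    obtain ⟨f, hf⟩ := geometric_hahn_banach_open_point
      (hK.convex.interior.sub hK.convex.interior) isOpen_interior.sub_right hx
    set w : Plane := (InnerProductSpace.toDual ℝ Plane).symm f with hw
    have hwf : ∀ y, ⟪w, y⟫ = f y := fun y => by
      rw [hw, InnerProductSpace.toDual_symm_apply]
    have hw0 : w ≠ 0 := by
      intro h
      obtain ⟨z, hz⟩ := hK.nonempty_interior
      have := hf _ (Set.sub_mem_sub hz hz)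
      rw [← hwf, ← hwf, h] at this
      simp at this
    have hs : ∀ y ∈ interior K - interior K, ⟪w, y⟫ ≤ ⟪w, x₀⟫ := fun y hy => by
      rw [hwf, hwf]; exact (hf y hy).le
    exact fin _ (norm_smul_inv_norm (𝕜 := ℝ) hw0) (hK.limit_nrm_of_support hU hKO hw0 hs)
      (hL.limit_nrm_of_support hU hLO hw0 (by rwa [← hKL]))

/-! ### Differentiability of the inscribed parallelogram -/

/-- If two moving points have difference `y` and move tangentially to the lines orthogonal to `u`
and `v`, then the first one is differentiable, with derivative the projection onto the first line
along the second one. -/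
lemma hasFDerivAt_obliqueProj {a b : Plane → Plane} {x u v : Plane} (hd : planeDet u v ≠ 0)
    (hab : ∀ᶠ y in nhds x, a y - b y = y)
    (hu : (fun y => ⟪u, a y - a x⟫) =o[nhds x] fun y => a y - a x)
    (hv : (fun y => ⟪v, b y - b x⟫) =o[nhds x] fun y => b y - b x) :
    HasFDerivAt a (obliqueProj u v) x := by
  have hx := hab.self_of_nhds
  have hβ : ∀ᶠ y in nhds x, b y - b x = (a y - a x) - (y - x) := by
    filter_upwards [hab] with y hy
    nth_rewrite 3 [← hy]; nth_rewrite 3 [← hx]; abel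
  set N : Plane → ℝ := fun y => ‖a y - a x‖ + ‖y - x‖ with hN
  have hNn : ∀ y, ‖N y‖ = N y := fun y => Real.norm_of_nonneg (by positivity)
  have hαN : (fun y => a y - a x) =O[nhds x] N :=
    Asymptotics.IsBigO.of_bound 1 (Filter.Eventually.of_forall fun y => by
      rw [hNn, one_mul]; simp [hN])
  have hβN : (fun y => b y - b x) =O[nhds x] N := by
    refine Asymptotics.IsBigO.of_bound 1 ?_
    filter_upwards [hβ] with y hy
    rw [hNn, one_mul, hy]
    exact norm_sub_le _ _
  have hE : (fun y => (a y - a x) - obliqueProj u v (y - x)) =o[nhds x] N := by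
    have h1 : (fun y => (planeDet u v)⁻¹ • (⟪v, b y - b x⟫ • quarterTurn u
        - ⟪u, a y - a x⟫ • quarterTurn v)) =o[nhds x] N := by
      refine Asymptotics.IsLittleO.const_smul_left (R := ℝ) ?_ _
      refine Asymptotics.IsLittleO.sub ?_ ?_
      · exact ((Asymptotics.isBigO_of_le' (c := ‖quarterTurn u‖) _ fun y => by
          rw [norm_smul, mul_comm]).trans_isLittleO (hv.trans_isBigO hβN))
      · exact ((Asymptotics.isBigO_of_le' (c := ‖quarterTurn v‖) _ fun y => by
          rw [norm_smul, mul_comm]).trans_isLittleO (hu.trans_isBigO hαN))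
    refine h1.congr' ?_ Filter.EventuallyEq.rfl
    filter_upwards [hβ] with y hy
    have e := planeDet_smul_eq u v (a y - a x)
    have e2 : a y - a x = (planeDet u v)⁻¹ • (planeDet u v • (a y - a x)) := by
      rw [smul_smul, inv_mul_cancel₀ hd, one_smul]
    rw [hy, inner_sub_right, obliqueProj_apply]
    nth_rewrite 3 [e2]
    rw [e, div_eq_inv_mul]
    module
  have hαh : (fun y => a y - a x) =O[nhds x] fun y => y - x := by
    refine Asymptotics.IsBigO.of_bound (2 * ‖obliqueProj u v‖ + 1) ?_
    filter_upwards [hE.bound (show (0 : ℝ) < 1 / 2 by norm_num)] with y hy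
    rw [hNn] at hy
    have h2 := (obliqueProj u v).le_opNorm (y - x)
    have h3 : ‖a y - a x‖ ≤ ‖(a y - a x) - obliqueProj u v (y - x)‖ + ‖obliqueProj u v (y - x)‖ := by
      simpa using norm_add_le ((a y - a x) - obliqueProj u v (y - x)) (obliqueProj u v (y - x))
    simp only [hN] at hy
    linarith
  have hNh : N =O[nhds x] fun y => y - x :=
    hαh.norm_left.add (Asymptotics.isBigO_refl _ _).norm_left
  exact HasFDerivAt.of_isLittleO (hE.trans_isBigO hNh)

/-- To first order, a vertex moves perpendicularly to its normal. The two supporting lines at the old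
and the new position bound the normal component by the change of the normal. -/
lemma IsSmoothBody.isLittleO_inner_nrm (hK : IsSmoothBody K) {x : Plane}
    (hx : x ∈ overlapDomain K) (i : Fin 4) :
    (fun y => ⟪nrm K x i, vert K y i - vert K x i⟫) =o[nhds x]
      fun y => vert K y i - vert K x i := by
  refine Asymptotics.IsLittleO.of_bound fun c hc => ?_
  have hcont := hK.continuousAt_nrm hx i
  have hev := Metric.tendsto_nhds.1 hcont c hc
  filter_upwards [hev, (isOpen_overlapDomain K).mem_nhds hx] with y hy hyO
  have H := hK.inscribed hx
  have H' := hK.inscribed hyO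
  rw [dist_eq_norm] at hy
  have h1 := H.normal i _ (H'.mem hK i)
  have h2 := H'.normal i _ (H.mem hK i)
  have h3 := real_inner_le_norm (nrm K y i - nrm K x i) (vert K y i - vert K x i)
  have h4 : ‖nrm K y i - nrm K x i‖ * ‖vert K y i - vert K x i‖ ≤
    c * ‖vert K y i - vert K x i‖ := mul_le_mul_of_nonneg_right hy.le (norm_nonneg _)
  rw [Real.norm_eq_abs, abs_le]
  rw [inner_sub_left, inner_sub_right, inner_sub_right] at h3
  rw [inner_sub_right]
  constructor
  · linarith
  · have : 0 ≤ c * ‖vert K y i - vert K x i‖ := by positivity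
    linarith

lemma IsSmoothBody.hasFDerivAt_vert_zero (hK : IsSmoothBody K) {x : Plane}
    (hx : x ∈ overlapDomain K) :
    HasFDerivAt (fun y => vert K y 0) (obliqueProj (nrm K x 0) (nrm K x 1)) x := by
  refine hasFDerivAt_obliqueProj ((hK.inscribed hx).planeDet_zero_one_pos hK).ne' ?_
    (hK.isLittleO_inner_nrm hx 0) (hK.isLittleO_inner_nrm hx 1)
  filter_upwards [(isOpen_overlapDomain K).mem_nhds hx] with y hy
  exact (hK.inscribed hy).top_edge.symm

lemma IsSmoothBody.hasFDerivAt_vert_three (hK : IsSmoothBody K) {x : Plane}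
    (hx : x ∈ overlapDomain K) :
    HasFDerivAt (fun y => vert K y 3) (obliqueProj (nrm K x 3) (nrm K x 2)) x := by
  refine hasFDerivAt_obliqueProj ?_ ?_
    (hK.isLittleO_inner_nrm hx 3) (hK.isLittleO_inner_nrm hx 2)
  · rw [planeDet_swap]
    exact (neg_neg_of_pos ((hK.inscribed hx).planeDet_two_three_pos hK)).ne
  filter_upwards [(isOpen_overlapDomain K).mem_nhds hx] with y hy
  exact (hK.inscribed hy).bottom_edge.symm

/-- The derivative of `side K`, in terms of the normals at the four vertices. -/
def sideDeriv (u : Fin 4 → Plane) : Plane →L[ℝ] Plane :=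
  obliqueProj (u 0) (u 1) - obliqueProj (u 3) (u 2)

lemma IsSmoothBody.hasFDerivAt_side (hK : IsSmoothBody K) {x : Plane}
    (hx : x ∈ overlapDomain K) : HasFDerivAt (side K) (sideDeriv (nrm K x)) x :=
  (hK.hasFDerivAt_vert_zero hx).sub (hK.hasFDerivAt_vert_three hx)

/-! ### The gradient of the covariogram -/

open MeasureTheory in
/-- The area of a parallelogram, in the coordinates given by two vectors. -/
lemma volume_planeDet_box {x d : Plane} (hΔ : 0 < planeDet x d) (c : Plane) (I J : Set ℝ) :
    volume {w : Plane | planeDet (w - c) d ∈ I ∧ planeDet x (w - c) ∈ J} =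
      ENNReal.ofReal (planeDet x d)⁻¹ * (volume I * volume J) := by
  set f : Plane →ₗ[ℝ] Plane := Matrix.toLin (EuclideanSpace.basisFun (Fin 2) ℝ).toBasis
    (EuclideanSpace.basisFun (Fin 2) ℝ).toBasis !![d 1, -d 0; -x 1, x 0] with hf
  have hdet : LinearMap.det f = planeDet x d := by
    rw [hf, LinearMap.det_toLin, Matrix.det_fin_two_of, planeDet]; ring
  have hfa : ∀ w : Plane, f w 0 = planeDet w d ∧ f w 1 = planeDet x w := by
    intro w
    have h := Matrix.toLin_apply (EuclideanSpace.basisFun (Fin 2) ℝ).toBasis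
      (EuclideanSpace.basisFun (Fin 2) ℝ).toBasis !![d 1, -d 0; -x 1, x 0] w
    constructor <;>
    · rw [hf, h]
      simp [Fin.sum_univ_two, planeDet, Matrix.mulVec, dotProduct]
      try ring
  set S : Set Plane := {v | v 0 ∈ I ∧ v 1 ∈ J} with hS
  have e1 : {w : Plane | planeDet (w - c) d ∈ I ∧ planeDet x (w - c) ∈ J} =
      (fun w => w + -c) ⁻¹' (f ⁻¹' S) := by
    ext w
    simp only [hS, Set.mem_preimage, Set.mem_ofPred_eq, (hfa _).1, (hfa _).2, ← sub_eq_add_neg]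
  have e2 : volume S = volume I * volume J := by
    have h := (EuclideanSpace.volume_preserving_symm_measurableEquiv_toLp
      (Fin 2)).measure_preimage_equiv (Set.univ.pi ![I, J])
    rw [volume_pi_pi, Fin.prod_univ_two] at h
    rw [← show (MeasurableEquiv.toLp 2 (Fin 2 → ℝ)).symm ⁻¹' (Set.univ.pi ![I, J]) = S by
      ext v
      simp [hS, Set.mem_pi, Fin.forall_fin_two]]
    exact h
  rw [e1, measure_preimage_add_right, Measure.addHaar_preimage_linearMap _ (by rw [hdet]; exact hΔ.ne'),
    hdet, abs_of_pos (inv_pos.2 hΔ), e2]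

lemma volume_real_planeDet_box {x d : Plane} (hΔ : 0 < planeDet x d) (c : Plane) {a₁ a₂ b₁ b₂ : ℝ}
    (ha : a₁ ≤ a₂) (hb : b₁ ≤ b₂) :
    MeasureTheory.volume.real {w : Plane | planeDet (w - c) d ∈ Set.Ico a₁ a₂ ∧
      planeDet x (w - c) ∈ Set.Icc b₁ b₂} = (a₂ - a₁) * (b₂ - b₁) / planeDet x d := by
  rw [MeasureTheory.measureReal_def, volume_planeDet_box hΔ, Real.volume_Ico, Real.volume_Icc,
    ENNReal.toReal_mul, ENNReal.toReal_mul, ENNReal.toReal_ofReal (inv_nonneg.2 hΔ.le),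
    ENNReal.toReal_ofReal (sub_nonneg.2 ha), ENNReal.toReal_ofReal (sub_nonneg.2 hb)]
  rw [div_eq_inv_mul]

lemma covariogram_eq (K : Set Plane) (x : Plane) :
    covariogram K x = MeasureTheory.volume.real (K ∩ {z | z - x ∈ K}) := by
  have : (fun y => y + x) '' K = {z | z - x ∈ K} := by
    ext z
    simp only [Set.mem_image, Set.mem_ofPred_eq]
    exact ⟨by rintro ⟨y, hy, rfl⟩; simpa using hy, fun h => ⟨_, h, by abel⟩⟩
  rw [covariogram, this]

/-- Coordinates of a vector with respect to the two edges of a parallelogram. -/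
lemma planeDet_smul_decomp (x d w : Plane) :
    planeDet x d • w = planeDet w d • x + planeDet x w • d := by
  apply plane_ext <;> simp [planeDet] <;> ring

namespace IsInscribedParallelogram

variable {x : Plane} {p u : Fin 4 → Plane}

section
variable (hK : IsSmoothBody K) (H : IsInscribedParallelogram K x p u)
include hK H

/-- The part of `K` to the right of the right edge of the inscribed parallelogram lies in
`K + x`. -/
lemma right_part_sub_mem {z : Plane} (hz : z ∈ K) (h : planeDet (p 0 - p 3) (z - p 3) ≤ 0) :
    z - x ∈ K := by
  set d := p 0 - p 3 with hd
  have hΔ : 0 < planeDet x d := H.planeDet_pos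
  have hdec := planeDet_smul_decomp x d (z - p 3)
  have e2 : p 2 = p 3 - x := by rw [H.bottom_edge]; abel
  set α := planeDet (z - p 3) d with hα
  set β := planeDet x (z - p 3) with hβ
  have hα0 : 0 ≤ α := by
    rw [hα, planeDet_swap]; linarith
  -- the normals at the ends of the right edge confine `z` to the strip spanned by that edge
  have hβ0 : 0 ≤ β := by
    have h3 := H.normal 3 z hz
    have h3' : ⟪u 3, z - p 3⟫ ≤ 0 := by rw [inner_sub_right]; linarith
    have h4 : planeDet x d * ⟪u 3, z - p 3⟫ = α * ⟪u 3, x⟫ + β * ⟪u 3, d⟫ := by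
      rw [← inner_smul_right, hdec, inner_add_right, inner_smul_right, inner_smul_right]
    have h5 := H.inner_three_pos hK
    have h6 := H.inner_three_side_neg hK
    by_contra! hc
    have := mul_pos_of_neg_of_neg hc h6
    have := mul_nonneg hα0 h5.le
    have := mul_nonneg hΔ.le (neg_nonneg.2 h3')
    linarith
  have hβ1 : β ≤ planeDet x d := by
    have h3 := H.normal 0 z hz
    have h3' : ⟪u 0, z - p 3⟫ ≤ ⟪u 0, d⟫ := by
      rw [hd, inner_sub_right, inner_sub_right]; linarith
    have h4 : planeDet x d * ⟪u 0, z - p 3⟫ = α * ⟪u 0, x⟫ + β * ⟪u 0, d⟫ := by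
      rw [← inner_smul_right, hdec, inner_add_right, inner_smul_right, inner_smul_right]
    have h5 := H.inner_zero_pos hK
    have h6 := H.inner_zero_side_pos hK
    by_contra! hc
    have := mul_pos (sub_pos.2 hc) h6
    have := mul_nonneg hα0 h5.le
    have := mul_nonneg hΔ.le (sub_nonneg.2 h3')
    linarith
  set Δ := planeDet x d with hΔd
  set t := β / Δ with ht
  have ht0 : 0 ≤ t := by positivity
  have ht1 : t ≤ 1 := (div_le_one hΔ).2 hβ1
  set a := α / Δ with ha
  have ha0 : 0 ≤ a := by positivity
  have hzd : z = p 3 + t • d + a • x := by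
    have : z - p 3 = Δ⁻¹ • (Δ • (z - p 3)) := by
      rw [smul_smul, inv_mul_cancel₀ hΔ.ne', one_smul]
    rw [hdec] at this
    rw [eq_add_of_sub_eq this, ht, ha, div_eq_inv_mul, div_eq_inv_mul]; module
  have hm : p 2 + t • d ∈ K := by
    have : p 2 + t • d = (1 - t) • p 2 + t • p 1 := by
      rw [hd, H.side_eq]; module
    rw [this]
    exact hK.convex (H.mem hK 2) (H.mem hK 1) (by linarith) ht0 (by ring)
  -- `z - x` lies between the left edge and `z`
  have hcomb : z - x = (1 / (1 + a)) • (p 2 + t • d) + (a / (1 + a)) • z := by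
    have h1 : (1 + a) ≠ 0 := by positivity
    have h2 : (1 + a) • (z - x) = (p 2 + t • d) + a • z := by
      rw [e2]
      nth_rewrite 1 [add_smul, one_smul]
      nth_rewrite 1 [hzd]
      module
    have h3 : z - x = (1 + a)⁻¹ • ((1 + a) • (z - x)) := by
      rw [smul_smul, inv_mul_cancel₀ h1, one_smul]
    rw [h3, h2, smul_add, smul_smul, one_div, div_eq_inv_mul]
  rw [hcomb]
  exact hK.convex hm hz (by positivity) (by positivity) (by field_simp)

/-- The part of `K` to the left of the left edge of the inscribed parallelogram lies in `K - x`. -/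
lemma left_part_add_mem {z : Plane} (hz : z ∈ K) (h : 0 ≤ planeDet (p 0 - p 3) (z - p 2)) :
    z + x ∈ K := by
  have h1 := H.neg.right_part_sub_mem hK.neg (z := -z) (by simpa using hz)
  simp only [show (0 : Fin 4) + 2 = 2 from rfl, show (3 : Fin 4) + 2 = 1 from rfl] at h1
  have h2 := h1 (by
    have e1 : p 1 - p 0 = -x := by rw [H.top_edge]; abel
    have : planeDet (-p 2 - -p 1) (-z - -p 1) = -planeDet (p 0 - p 3) (z - p 2) := by
      have hs := H.side_eq
      rw [show -p 2 - -p 1 = p 0 - p 3 by rw [hs]; abel]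
      have : z - p 2 = (z - p 1) + (p 0 - p 3) := by rw [hs]; abel
      rw [this]
      simp only [planeDet, PiLp.add_apply, PiLp.sub_apply, PiLp.neg_apply]; ring
    rw [this]; linarith)
  have : -z - x ∈ -K := h2
  rw [Set.mem_neg] at this
  convert this using 1; abel

open MeasureTheory in
/-- The covariogram at any other vector, compared with the covariogram at `x`: the line through the
right edge of the inscribed parallelogram splits `K ∩ (K + x)` into a part of `K` and a part of
`K + x`, and for another vector it gives an upper bound. -/
lemma covariogram_add_le (h : Plane) :
    covariogram K (x + h) + volume.real {w ∈ K | planeDet (w - p 2) (p 0 - p 3) < 0} ≤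
      covariogram K x +
        volume.real {w ∈ K | planeDet (w - p 2) (p 0 - p 3) < planeDet (p 0 - p 3) h} := by
  set d := p 0 - p 3 with hd
  have e3 : p 3 = p 2 + x := by rw [H.bottom_edge]; abel
  have hcont : Continuous fun z => planeDet d (z - p 3) :=
    (planeDet_const_continuous d).comp (by fun_prop)
  set R : Set Plane := {z | planeDet d (z - p 3) ≤ 0} with hR
  have hRm : MeasurableSet R := (isClosed_le hcont continuous_const).measurableSet
  have hKm : MeasurableSet K := hK.compact.isClosed.measurableSet
  have hKf : volume K ≠ ⊤ := hK.compact.measure_lt_top.ne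
  have hsub : ∀ y, MeasurableSet {z : Plane | z - y ∈ K} := fun y =>
    hKm.preimage (measurable_id.sub_const y)
  have hsubf : ∀ y, volume {z : Plane | z - y ∈ K} ≠ ⊤ := fun y => by
    have : {z : Plane | z - y ∈ K} = (fun z => z + -y) ⁻¹' K := by
      ext z; simp [sub_eq_add_neg]
    rw [this, measure_preimage_add_right]; exact hKf
  have split : ∀ y, covariogram K y = volume.real (K ∩ {z | z - y ∈ K} ∩ R) +
      volume.real (K ∩ {z | z - y ∈ K} ∩ Rᶜ) := fun y => by
    rw [covariogram_eq, ← Set.sdiff_eq, measureReal_inter_add_sdiff hRm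
      (ne_top_of_le_ne_top hKf (measure_mono Set.inter_subset_left))]
  have transl : ∀ k : Plane, volume.real ({z | z - (x + k) ∈ K} ∩ Rᶜ) =
      volume.real {w ∈ K | planeDet (w - p 2) d < planeDet d k} := fun k => by
    have : {z | z - (x + k) ∈ K} ∩ Rᶜ =
        (fun z => z + -(x + k)) ⁻¹' {w ∈ K | planeDet (w - p 2) d < planeDet d k} := by
      ext z
      simp only [hR, Set.mem_inter_iff, Set.mem_compl_iff, Set.mem_ofPred_eq, Set.mem_preimage, not_le,
        ← sub_eq_add_neg, and_congr_right_iff]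
      intro _
      rw [e3]
      simp only [planeDet, PiLp.add_apply, PiLp.sub_apply]
      constructor <;> intro h <;> linarith
    rw [this, measureReal_def, measure_preimage_add_right, ← measureReal_def]
  have hx : covariogram K x = volume.real (K ∩ R) +
      volume.real {w ∈ K | planeDet (w - p 2) d < 0} := by
    have h0 : planeDet d (0 : Plane) = 0 := by simp [planeDet]
    rw [← h0, ← transl 0, add_zero, split x]
    congr 2
    · ext z
      simp only [Set.mem_inter_iff, Set.mem_ofPred_eq, hR]
      exact ⟨fun h => ⟨h.1.1, h.2⟩, fun h => ⟨⟨h.1, H.right_part_sub_mem hK h.1 h.2⟩, h.2⟩⟩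
    · ext z
      simp only [Set.mem_inter_iff, Set.mem_ofPred_eq, hR, Set.mem_compl_iff, not_le]
      refine ⟨fun h => ⟨h.1.2, h.2⟩, fun h => ⟨⟨?_, h.1⟩, h.2⟩⟩
      have := H.left_part_add_mem hK h.1 (by
        have h2 := h.2
        rw [e3, ← sub_sub] at h2
        rw [sub_right_comm]
        exact h2.le)
      simpa using this
  have hy : covariogram K (x + h) ≤ volume.real (K ∩ R) +
      volume.real {w ∈ K | planeDet (w - p 2) d < planeDet d h} := by
    rw [← transl h, split]
    refine add_le_add (measureReal_mono ?_ ?_) (measureReal_mono ?_ ?_)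
    · exact Set.inter_subset_inter_left _ Set.inter_subset_left
    · exact ne_top_of_le_ne_top hKf (measure_mono Set.inter_subset_left)
    · exact Set.inter_subset_inter_left _ Set.inter_subset_right
    · exact ne_top_of_le_ne_top (hsubf _) (measure_mono Set.inter_subset_left)
  linarith

end
end IsInscribedParallelogram

namespace IsInscribedParallelogram

variable {x : Plane} {p u : Fin 4 → Plane}

open MeasureTheory in
/-- Second order estimate for the area cut off from `K` by a line parallel to the left edge of the
inscribed parallelogram. To the right of that edge, `K` is confined by the two supporting lines;
to the left, it contains the triangle spanned by the edge and a further point of `K`. -/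
lemma cap_volume_le (hK : IsSmoothBody K) (H : IsInscribedParallelogram K x p u) {κ ε : ℝ}
    (hε : 0 < ε) (hκ1 : -⟪u 1, x⟫ ≤ κ * ⟪u 1, p 0 - p 3⟫)
    (hκ2 : -⟪u 2, x⟫ ≤ κ * -⟪u 2, p 0 - p 3⟫)
    (hm : p 2 + (1 / 2 : ℝ) • (p 0 - p 3) - ε • x ∈ K) (c : ℝ) :
    volume.real {w ∈ K | planeDet (w - p 2) (p 0 - p 3) < c} ≤
      volume.real {w ∈ K | planeDet (w - p 2) (p 0 - p 3) < 0} + c +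
        (2 * κ + ε⁻¹) / planeDet x (p 0 - p 3) * c ^ 2 := by
  set d := p 0 - p 3 with hd
  have hΔ : 0 < planeDet x d := H.planeDet_pos
  set Δ := planeDet x d with hΔd
  have e1 : p 1 = p 2 + d := by rw [hd, H.side_eq]; abel
  have hKf : volume K ≠ ⊤ := hK.compact.measure_lt_top.ne
  have hκ0 : 0 < κ := by
    have h1 := H.inner_one_neg hK
    have h2 := H.inner_one_side_pos hK
    exact pos_of_mul_pos_left (by linarith) h2.le
  have hcont : Continuous fun w => planeDet (w - p 2) d := by unfold planeDet; fun_prop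
  have hmeas : ∀ b, MeasurableSet {w : Plane | planeDet (w - p 2) d < b} := fun b =>
    (isOpen_lt hcont continuous_const).measurableSet
  -- the strip between two parallels is the difference of two caps
  have strip : ∀ a b : ℝ, a ≤ b → volume.real {w ∈ K | planeDet (w - p 2) d < b} =
      volume.real {w ∈ K | planeDet (w - p 2) d < a} +
      volume.real {w ∈ K | planeDet (w - p 2) d ∈ Set.Ico a b} := fun a b hab => by
    rw [← measureReal_inter_add_sdiff (s := {w ∈ K | planeDet (w - p 2) d < b}) (hmeas a)
      (ne_top_of_le_ne_top hKf (measure_mono fun w hw => hw.1))]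
    congr 2
    · ext w
      simp only [Set.mem_inter_iff, Set.mem_ofPred_eq]
      exact ⟨fun h => ⟨h.1.1, h.2⟩, fun h => ⟨⟨h.1, h.2.trans_le hab⟩, h.2⟩⟩
    · ext w
      simp only [Set.mem_sdiff, Set.mem_ofPred_eq, Set.mem_Ico, not_lt]
      tauto
  have hin : ∀ (v w : Plane), Δ * ⟪v, w⟫ = planeDet w d * ⟪v, x⟫ + planeDet x w * ⟪v, d⟫ := by
    intro v w
    rw [← inner_smul_right, planeDet_smul_decomp, inner_add_right, inner_smul_right,
      inner_smul_right]
  rcases le_or_gt 0 c with hc | hc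
  · rw [strip 0 c hc]
    have hsub : {w ∈ K | planeDet (w - p 2) d ∈ Set.Ico 0 c} ⊆
        {w : Plane | planeDet (w - p 2) d ∈ Set.Ico 0 c ∧
          planeDet x (w - p 2) ∈ Set.Icc (-(κ * c)) (Δ + κ * c)} := by
      rintro w ⟨hw, hwc⟩
      refine ⟨hwc, ?_, ?_⟩
      · have h1 := H.normal 2 w hw
        have h2 : ⟪u 2, w - p 2⟫ ≤ 0 := by rw [inner_sub_right]; linarith
        have h3 := hin (u 2) (w - p 2)
        have h4 := H.inner_two_side_neg hK
        by_contra! hcon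
        have h5 : planeDet (w - p 2) d * -⟪u 2, x⟫ ≤ c * (κ * -⟪u 2, d⟫) :=
          mul_le_mul hwc.2.le hκ2 (neg_nonneg.2 (H.inner_two_neg hK).le) hc
        have h6 := mul_pos (sub_pos.2 hcon) (neg_pos.2 h4)
        have h7 := mul_nonneg hΔ.le (neg_nonneg.2 h2)
        linarith
      · have h1 := H.normal 1 w hw
        have h2 : ⟪u 1, w - p 2⟫ ≤ ⟪u 1, d⟫ := by
          rw [e1, inner_add_right] at h1; rw [inner_sub_right]; linarith
        have h3 := hin (u 1) (w - p 2)
        have h4 := H.inner_one_side_pos hK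
        by_contra! hcon
        have h5 : planeDet (w - p 2) d * -⟪u 1, x⟫ ≤ c * (κ * ⟪u 1, d⟫) :=
          mul_le_mul hwc.2.le hκ1 (neg_nonneg.2 (H.inner_one_neg hK).le) hc
        have h6 := mul_pos (sub_pos.2 hcon) h4
        have h7 := mul_nonneg hΔ.le (sub_nonneg.2 h2)
        linarith
    have hbox := volume_real_planeDet_box hΔ (p 2) hc
      (show -(κ * c) ≤ Δ + κ * c by have := mul_nonneg hκ0.le hc; linarith)
    have hfin := volume_planeDet_box hΔ (p 2) (Set.Ico 0 c) (Set.Icc (-(κ * c)) (Δ + κ * c))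
    have hle := measureReal_mono hsub (by
      rw [hfin, Real.volume_Ico, Real.volume_Icc]
      exact ENNReal.mul_ne_top ENNReal.ofReal_ne_top
        (ENNReal.mul_ne_top ENNReal.ofReal_ne_top ENNReal.ofReal_ne_top))
    rw [hbox] at hle
    have e : (c - 0) * (Δ + κ * c - -(κ * c)) / Δ = c + 2 * κ / Δ * c ^ 2 := by
      field_simp; ring
    rw [e] at hle
    have : 0 ≤ ε⁻¹ / Δ * c ^ 2 := by positivity
    have e' : (2 * κ + ε⁻¹) / Δ * c ^ 2 = 2 * κ / Δ * c ^ 2 + ε⁻¹ / Δ * c ^ 2 := by ring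
    linarith
  · rw [strip c 0 hc.le]
    suffices hs : -c - ε⁻¹ / Δ * c ^ 2 ≤
        volume.real {w ∈ K | planeDet (w - p 2) d ∈ Set.Ico c 0} by
      have : 0 ≤ 2 * κ / Δ * c ^ 2 := by positivity
      have e' : (2 * κ + ε⁻¹) / Δ * c ^ 2 = 2 * κ / Δ * c ^ 2 + ε⁻¹ / Δ * c ^ 2 := by ring
      linarith
    rcases le_or_gt (-c) (ε * Δ) with hcε | hcε
    · set s : ℝ := -c / (2 * ε) with hsdef
      have hs0 : 0 ≤ s := div_nonneg (by linarith) (by positivity)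
      have hs1 : s ≤ Δ - s := by
        have : 2 * s ≤ Δ := by
          rw [hsdef]
          have : 2 * (-c / (2 * ε)) = -c / ε := by field_simp
          rw [this, div_le_iff₀ hε]; linarith
        linarith
      have hsub : {w : Plane | planeDet (w - p 2) d ∈ Set.Ico c 0 ∧
          planeDet x (w - p 2) ∈ Set.Icc s (Δ - s)} ⊆
          {w ∈ K | planeDet (w - p 2) d ∈ Set.Ico c 0} := by
        rintro w ⟨hwc, hws⟩
        refine ⟨?_, hwc⟩
        -- barycentric coordinates in the triangle `p 1`, `p 2`, `m`
        set a := planeDet (w - p 2) d with ha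
        set t := planeDet x (w - p 2) with ht
        set l : ℝ := -a / (ε * Δ) with hl
        have hl0 : 0 ≤ l := div_nonneg (by linarith [hwc.2]) (by positivity)
        have hls : l / 2 ≤ s / Δ := by
          rw [hl, hsdef, div_div, div_div, div_le_div_iff₀ (by positivity) (by positivity)]
          have := hwc.1
          have : 0 < ε * Δ := by positivity
          nlinarith
        have ht1 : s / Δ ≤ t / Δ := div_le_div_of_nonneg_right hws.1 hΔ.le
        have ht2 : t / Δ ≤ 1 - s / Δ := by
          rw [← div_self hΔ.ne', ← sub_div]
          exact div_le_div_of_nonneg_right hws.2 hΔ.le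
        have hw : w = (t / Δ - l / 2) • p 1 + (1 - t / Δ - l / 2) • p 2 +
            l • (p 2 + (1 / 2 : ℝ) • d - ε • x) := by
          have h1 : w - p 2 = Δ⁻¹ • (Δ • (w - p 2)) := by
            rw [smul_smul, inv_mul_cancel₀ hΔ.ne', one_smul]
          rw [planeDet_smul_decomp, ← ha, ← ht] at h1
          rw [eq_add_of_sub_eq h1, e1]
          have h2 : l * ε = -a / Δ := by rw [hl]; field_simp
          have h3 : l • ε • x = (-a / Δ) • x := by rw [smul_smul, h2]
          rw [smul_sub l, h3, div_eq_inv_mul t, div_eq_inv_mul (-a)]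
          module
        rw [hw]
        have hmem := hK.convex.sum_mem (t := Finset.univ)
          (w := ![t / Δ - l / 2, 1 - t / Δ - l / 2, l])
          (z := ![p 1, p 2, p 2 + (1 / 2 : ℝ) • d - ε • x])
          (by intro i _; fin_cases i <;> simp <;> linarith)
          (by simp [Fin.sum_univ_three]; ring)
          (by intro i _; fin_cases i
              exacts [H.mem hK 1, H.mem hK 2, hm])
        simpa [Fin.sum_univ_three] using hmem
      have hle := measureReal_mono hsub (ne_top_of_le_ne_top hKf (measure_mono fun w hw => hw.1))
      rw [volume_real_planeDet_box hΔ (p 2) hc.le hs1] at hle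
      refine le_trans (le_of_eq ?_) hle
      rw [← hΔd, hsdef]; field_simp; ring
    · refine le_trans ?_ measureReal_nonneg
      have h1 : 1 ≤ ε⁻¹ / Δ * -c := by
        rw [div_mul_eq_mul_div, le_div_iff₀ hΔ, inv_mul_eq_div, le_div_iff₀ hε]; linarith
      nlinarith

end IsInscribedParallelogram

lemma abs_planeDet_le (a b : Plane) : |planeDet a b| ≤ ‖a‖ * ‖b‖ := by
  have := abs_real_inner_le_norm b (quarterTurn a)
  rwa [inner_quarterTurn, norm_quarterTurn, mul_comm] at this

namespace IsSmoothBody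

lemma continuousAt_side (hK : IsSmoothBody K) {x : Plane} (hx : x ∈ overlapDomain K) :
    ContinuousAt (side K) x :=
  (hK.hasFDerivAt_side hx).continuousAt

/-- One-sided second order estimate for the covariogram, locally uniform in the base point. -/
lemma exists_covariogram_le (hK : IsSmoothBody K) {x : Plane} (hx : x ∈ overlapDomain K) :
    ∃ C : ℝ, ∀ᶠ y in nhds x, ∀ h, covariogram K (y + h) ≤
      covariogram K y + planeDet (side K y) h + C * ‖h‖ ^ 2 := by
  have H := hK.inscribed hx
  have hs := hK.continuousAt_side hx
  have hid : ContinuousAt (fun y : Plane => y) x := continuousAt_id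
  have hv := hK.continuousAt_vert hx
  have hn := hK.continuousAt_nrm hx
  -- the constants at `x`, with some room
  obtain ⟨κ, hκ1, hκ2⟩ : ∃ κ : ℝ, -⟪nrm K x 1, x⟫ < κ * ⟪nrm K x 1, side K x⟫ ∧
      -⟪nrm K x 2, x⟫ < κ * -⟪nrm K x 2, side K x⟫ := by
    have h1 : 0 < ⟪nrm K x 1, side K x⟫ := H.inner_one_side_pos hK
    have h2 : 0 < -⟪nrm K x 2, side K x⟫ := neg_pos.2 (H.inner_two_side_neg hK)
    refine ⟨max (-⟪nrm K x 1, x⟫ / ⟪nrm K x 1, side K x⟫)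
      (-⟪nrm K x 2, x⟫ / -⟪nrm K x 2, side K x⟫) + 1, ?_, ?_⟩
    · rw [← div_lt_iff₀ h1]; exact (le_max_left _ _).trans_lt (lt_add_one _)
    · rw [← div_lt_iff₀ h2]; exact (le_max_right _ _).trans_lt (lt_add_one _)
  have hm0 : vert K x 2 + (1 / 2 : ℝ) • side K x ∈ interior K := by
    have h2 : vert K x 1 ≠ vert K x 2 := fun h => H.side_ne_zero (by rw [H.side_eq, h, sub_self])
    have m2 := hK.strictConvex (H.mem hK 1) (H.mem hK 2) h2 (a := 1/2) (b := 1/2) (by norm_num)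
      (by norm_num) (by norm_num)
    convert m2 using 1
    rw [side, H.side_eq]; module
  obtain ⟨ε, hm, hε⟩ : ∃ ε : ℝ, vert K x 2 + (1 / 2 : ℝ) • side K x - ε • x ∈ interior K ∧
      0 < ε := by
    have hc : Continuous fun ε : ℝ => vert K x 2 + (1 / 2 : ℝ) • side K x - ε • x := by fun_prop
    have h := hc.tendsto 0
    simp only [zero_smul, sub_zero] at h
    have h1 := h.eventually (isOpen_interior.mem_nhds hm0)
    exact ((h1.filter_mono nhdsWithin_le_nhds).and
      (self_mem_nhdsWithin (s := Set.Ioi (0 : ℝ)))).exists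
  have hΔ : 0 < planeDet x (side K x) := H.planeDet_pos
  have ci : ∀ i, ContinuousAt (fun y => ⟪nrm K y i, y⟫) x := fun i => (hn i).inner (𝕜 := ℝ) hid
  have cs : ∀ i, ContinuousAt (fun y => ⟪nrm K y i, side K y⟫) x := fun i => (hn i).inner (𝕜 := ℝ) hs
  have ev1 : ∀ᶠ y in nhds x, -⟪nrm K y 1, y⟫ < κ * ⟪nrm K y 1, side K y⟫ :=
    (ci 1).neg.eventually_lt (continuousAt_const.mul (cs 1)) hκ1
  have ev2 : ∀ᶠ y in nhds x, -⟪nrm K y 2, y⟫ < κ * -⟪nrm K y 2, side K y⟫ :=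
    (ci 2).neg.eventually_lt (continuousAt_const.mul (cs 2).neg) hκ2
  have ev3 : ∀ᶠ y in nhds x, vert K y 2 + (1 / 2 : ℝ) • side K y - ε • y ∈ interior K := by
    have hc : Continuous fun q : Plane × Plane × Plane =>
        q.1 + (1 / 2 : ℝ) • q.2.1 - ε • q.2.2 := by fun_prop
    have ht := (hc.tendsto (vert K x 2, side K x, x)).eventually (isOpen_interior.mem_nhds hm)
    have hp := (hv 2).prodMk_nhds (hs.prodMk_nhds hid)
    exact hp.eventually ht
  have ev4 : ∀ᶠ y in nhds x, planeDet x (side K x) / 2 < planeDet y (side K y) :=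
    (Filter.Tendsto.planeDet hid hs).eventually_const_lt (half_lt_self hΔ)
  have ev5 : ∀ᶠ y in nhds x, ‖side K y‖ < ‖side K x‖ + 1 :=
    hs.norm.eventually_lt_const (lt_add_one _)
  have ev6 := (isOpen_overlapDomain K).mem_nhds hx
  refine ⟨(2 * κ + ε⁻¹) / (planeDet x (side K x) / 2) * (‖side K x‖ + 1) ^ 2, ?_⟩
  filter_upwards [ev1, ev2, ev3, ev4, ev5, ev6] with y h1 h2 h3 h4 h5 h6 h
  have Hy := hK.inscribed h6
  have ha := Hy.covariogram_add_le hK h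
  have hb := Hy.cap_volume_le hK (κ := κ) (ε := ε) hε h1.le h2.le (interior_subset h3)
    (planeDet (side K y) h)
  rw [show vert K y 0 - vert K y 3 = side K y from rfl] at ha hb
  have hκ0 : 0 < κ := by
    have a1 := Hy.inner_one_neg hK
    have a2 : 0 < ⟪nrm K y 1, side K y⟫ := Hy.inner_one_side_pos hK
    exact pos_of_mul_pos_left (by linarith) a2.le
  have hq : (2 * κ + ε⁻¹) / planeDet y (side K y) * planeDet (side K y) h ^ 2 ≤
      (2 * κ + ε⁻¹) / (planeDet x (side K x) / 2) * (‖side K x‖ + 1) ^ 2 * ‖h‖ ^ 2 := by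
    rw [mul_assoc, ← mul_pow]
    have hd : |planeDet (side K y) h| ≤ (‖side K x‖ + 1) * ‖h‖ :=
      (abs_planeDet_le _ _).trans (mul_le_mul_of_nonneg_right h5.le (norm_nonneg _))
    rw [← sq_abs (planeDet (side K y) h)]
    gcongr
  linarith

/-- The gradient of the covariogram at `x` is the quarter turn of the second edge of the inscribed
parallelogram. -/
lemma hasFDerivAt_covariogram (hK : IsSmoothBody K) {x : Plane} (hx : x ∈ overlapDomain K) :
    HasFDerivAt (covariogram K) (innerSL ℝ (quarterTurn (side K x))) x := by
  obtain ⟨C, hC⟩ := hK.exists_covariogram_le hx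
  have hin : ∀ a b : Plane, ⟪quarterTurn a, b⟫ = planeDet a b := fun a b => by
    rw [real_inner_comm, inner_quarterTurn]
  refine HasFDerivAt.of_isLittleO (Asymptotics.IsLittleO.of_bound fun c hc => ?_)
  have hs := hK.continuousAt_side hx
  have ev1 : ∀ᶠ y in nhds x, ‖side K y - side K x‖ < c / 2 := by
    have := Metric.tendsto_nhds.1 hs (c / 2) (half_pos hc)
    simpa only [dist_eq_norm] using this
  have ev2 : ∀ᶠ y in nhds x, |C| * ‖y - x‖ < c / 2 := by
    have hc' : Continuous fun y : Plane => |C| * ‖y - x‖ := by fun_prop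
    have h := hc'.tendsto x
    simp only [sub_self, norm_zero, mul_zero] at h
    exact h.eventually_lt_const (half_pos hc)
  filter_upwards [ev1, ev2, hC] with y h1 h2 h3
  have hup := hC.self_of_nhds (y - x)
  have hlo := h3 (x - y)
  rw [add_sub_cancel] at hup hlo
  rw [innerSL_apply_apply, hin, Real.norm_eq_abs]
  have hCn : C * ‖y - x‖ ^ 2 ≤ c / 2 * ‖y - x‖ := by
    have := mul_le_mul_of_nonneg_right h2.le (norm_nonneg (y - x))
    have h5 := mul_le_mul_of_nonneg_right (le_abs_self C) (sq_nonneg ‖y - x‖)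
    nlinarith
  rw [norm_sub_rev x y] at hlo
  have h4 : planeDet (side K y) (x - y) =
      -planeDet (side K x) (y - x) - planeDet (side K y - side K x) (y - x) := by
    simp only [planeDet, PiLp.sub_apply]; ring
  have h5 := (abs_planeDet_le (side K y - side K x) (y - x)).trans
    (mul_le_mul_of_nonneg_right h1.le (norm_nonneg _))
  rw [abs_le] at h5 ⊢
  have h6 : 0 ≤ c / 2 * ‖y - x‖ := by positivity
  constructor <;> linarith [h5.1, h5.2]

end IsSmoothBody

/-! ### The Hessian of the covariogram -/

lemma sideDeriv_apply (u : Fin 4 → Plane) (z : Plane) :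
    sideDeriv u z = (⟪u 1, z⟫ / planeDet (u 0) (u 1)) • quarterTurn (u 0) -
      (⟪u 2, z⟫ / planeDet (u 3) (u 2)) • quarterTurn (u 3) := by
  simp [sideDeriv, obliqueProj_apply]

lemma planeDet_sideDeriv (u : Fin 4 → Plane) (z w : Plane) :
    planeDet (sideDeriv u z) w = ⟪u 2, z⟫ * ⟪u 3, w⟫ / planeDet (u 3) (u 2) -
      ⟪u 1, z⟫ * ⟪u 0, w⟫ / planeDet (u 0) (u 1) := by
  have h1 := planeDet_obliqueProj (u 0) (u 1) z w
  have h2 := planeDet_obliqueProj (u 3) (u 2) z w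
  have : planeDet (sideDeriv u z) w = planeDet (obliqueProj (u 0) (u 1) z) w -
      planeDet (obliqueProj (u 3) (u 2) z) w := by
    simp only [sideDeriv, planeDet, sub_apply, PiLp.sub_apply]; ring
  rw [this, h1, h2]; ring

namespace IsSmoothBody

lemma partialDeriv_covariogram (hK : IsSmoothBody K) {x : Plane} (hx : x ∈ overlapDomain K)
    (i : Fin 2) : partialDeriv i (covariogram K) x = quarterTurn (side K x) i := by
  rw [partialDeriv, ((hK.hasFDerivAt_covariogram hx).hasLineDerivAt _).lineDeriv,
    innerSL_apply_apply, plane_inner_eq]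
  fin_cases i <;> simp

lemma det_hessianMatrix (hK : IsSmoothBody K) {x : Plane} (hx : x ∈ overlapDomain K) :
    (hessianMatrix (covariogram K) x).det =
      planeDet (sideDeriv (nrm K x) (EuclideanSpace.single 0 1))
        (sideDeriv (nrm K x) (EuclideanSpace.single 1 1)) := by
  have hs := hK.hasFDerivAt_side hx
  have hc : ∀ j, HasFDerivAt (fun y => side K y j)
      ((EuclideanSpace.proj j : Plane →L[ℝ] ℝ).comp (sideDeriv (nrm K x))) x := fun j =>
    (EuclideanSpace.proj j : Plane →L[ℝ] ℝ).hasFDerivAt.comp x hs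
  have hev : ∀ j, ∀ᶠ y in nhds x, partialDeriv j (covariogram K) y = quarterTurn (side K y) j :=
    fun j => by
      filter_upwards [(isOpen_overlapDomain K).mem_nhds hx] with y hy
      exact hK.partialDeriv_covariogram hy j
  have h0 : ∀ i, hessianMatrix (covariogram K) x i 0 =
      -(sideDeriv (nrm K x) (EuclideanSpace.single i 1)) 1 := fun i => by
    have h : HasFDerivAt (partialDeriv 0 (covariogram K)) _ x :=
      (hc 1).neg.congr_of_eventuallyEq (by
        filter_upwards [hev 0] with y hy
        rw [hy, quarterTurn_zero_coord]; rfl)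
    change lineDeriv ℝ _ x _ = _
    rw [(h.hasLineDerivAt _).lineDeriv]
    rfl
  have h1 : ∀ i, hessianMatrix (covariogram K) x i 1 =
      (sideDeriv (nrm K x) (EuclideanSpace.single i 1)) 0 := fun i => by
    have h : HasFDerivAt (partialDeriv 1 (covariogram K)) _ x :=
      (hc 0).congr_of_eventuallyEq (by
        filter_upwards [hev 1] with y hy
        rw [hy, quarterTurn_one_coord])
    change lineDeriv ℝ _ x _ = _
    rw [(h.hasLineDerivAt _).lineDeriv]
    rfl
  rw [Matrix.det_fin_two, h0, h0, h1, h1, planeDet]; ring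

/-- If the normals at two opposite vertices are antipodal, the Hessian determinant is `-1`. -/
lemma det_hessianMatrix_of_antipodal (hK : IsSmoothBody K) {x : Plane}
    (hx : x ∈ overlapDomain K) (h : nrm K x 0 = -nrm K x 2) :
    (hessianMatrix (covariogram K) x).det = -1 := by
  have H := hK.inscribed hx
  have d1 := H.planeDet_zero_one_pos hK
  have d2 := H.planeDet_two_three_pos hK
  rw [hK.det_hessianMatrix hx, planeDet_sideDeriv]
  set u := nrm K x with hu
  have e : u 2 = -u 0 := by rw [h, neg_neg]
  rw [e] at d2
  have hm : planeDet (u 3) (-u 0) = planeDet (u 0) (u 3) := by simp [planeDet]; ring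
  have d3 : planeDet (u 0) (u 3) < 0 := by
    rw [← hm, planeDet_swap]; linarith
  rw [e, hm, plane_inner_eq (u 3) (sideDeriv u _), plane_inner_eq (u 0) (sideDeriv u _),
    sideDeriv_apply, e, hm]
  obtain ⟨m, hm'⟩ : ∃ m, m = planeDet (u 0) (u 3) := ⟨_, rfl⟩
  obtain ⟨n, hn'⟩ : ∃ n, n = planeDet (u 0) (u 1) := ⟨_, rfl⟩
  rw [← hm'] at d3 ⊢
  rw [← hn'] at d1 ⊢
  have hm0 := d3.ne
  have hn0 := d1.ne'
  simp [plane_inner_eq]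
  field_simp
  rw [hm', hn']
  simp only [planeDet]
  ring

end IsSmoothBody

open MeasureTheory in
lemma IsSmoothBody.covariogram_ne_zero_iff (hK : IsSmoothBody K) {x : Plane} :
    covariogram K x ≠ 0 ↔ x ∈ interior K - interior K := by
  rw [covariogram_eq]
  have hKf : volume K ≠ ⊤ := hK.compact.measure_lt_top.ne
  set S : Set Plane := K ∩ {z | z - x ∈ K} with hS
  have hSf : volume S ≠ ⊤ := ne_top_of_le_ne_top hKf (measure_mono Set.inter_subset_left)
  constructor
  · intro h
    have hconv : Convex ℝ S := by
      refine hK.convex.inter ?_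
      have := hK.convex.translate_preimage_left (-x)
      simpa [sub_eq_add_neg, Set.preimage] using this
    have hne : (interior S).Nonempty := by
      by_contra hemp
      rw [Set.not_nonempty_iff_eq_empty] at hemp
      apply h
      have h1 : S ⊆ frontier S := by
        rw [frontier, hemp, Set.sdiff_empty]; exact subset_closure
      rw [measureReal_def, measure_mono_null h1 (hconv.addHaar_frontier volume)]
      rfl
    obtain ⟨z, hz⟩ := hne
    have h1 : z ∈ interior K := interior_mono Set.inter_subset_left hz
    have h2 : z - x ∈ interior K := by
      have hz2 : z ∈ interior ((Homeomorph.subRight x) ⁻¹' K) := interior_mono Set.inter_subset_right hz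
      rw [← (Homeomorph.subRight x).preimage_interior] at hz2
      exact hz2
    exact ⟨z, h1, z - x, h2, sub_sub_cancel z x⟩
  · rintro ⟨z, hz, w, hw, rfl⟩
    rw [measureReal_def, ENNReal.toReal_ne_zero]
    refine ⟨?_, hSf⟩
    have hopen : IsOpen (interior K ∩ {y | y - (z - w) ∈ interior K}) :=
      isOpen_interior.inter (isOpen_interior.preimage (by fun_prop))
    have hpos := hopen.measure_pos volume ⟨z, hz, by simpa using hw⟩
    have hsub : interior K ∩ {y | y - (z - w) ∈ interior K} ⊆ S := by
      rintro y ⟨h1, h2⟩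
      have h3 : y - (z - w) ∈ K := interior_subset (show y - (z - w) ∈ interior K from h2)
      exact ⟨interior_subset h1, h3⟩
    exact (hpos.trans_le (measure_mono hsub)).ne'

lemma mem_overlapDomain_iff {x : Plane} :
    x ∈ overlapDomain K ↔ x ≠ 0 ∧ x ∈ interior K - interior K := by
  refine and_congr_right fun _ => ⟨?_, ?_⟩
  · rintro ⟨z, h1, h2⟩
    exact ⟨z, h1, z - x, h2, sub_sub_cancel z x⟩
  · rintro ⟨z, h1, w, h2, rfl⟩
    exact ⟨z, h1, by simpa using h2⟩

lemma IsSmoothBody.mem_overlapDomain (hK : IsSmoothBody K) {x : Plane}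
    (hx : x ∈ interior (tsupport (covariogram K)) \ {0}) : x ∈ overlapDomain K := by
  have hsupp : Function.support (covariogram K) = interior K - interior K := by
    ext y; exact hK.covariogram_ne_zero_iff
  have hopen : IsOpen (interior K - interior K) := isOpen_interior.sub_right
  have hne : (interior (interior K - interior K)).Nonempty := by
    rw [hopen.interior_eq]
    exact hK.nonempty_interior.sub hK.nonempty_interior
  rw [tsupport, hsupp,
    (hK.convex.interior.sub hK.convex.interior).interior_closure_eq_interior_of_nonempty_interior
      hne, hopen.interior_eq] at hx
  exact mem_overlapDomain_iff.2 ⟨hx.2, hx.1⟩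

/-! ### Two bodies with the same covariogram -/

/-- Two strictly convex and smooth bodies with the same covariogram. -/
structure IsCovariogramPair (K L : Set Plane) : Prop where
  left : IsSmoothBody K
  right : IsSmoothBody L
  covariogram_eq : covariogram K = covariogram L

namespace IsCovariogramPair

lemma symm (h : IsCovariogramPair K L) : IsCovariogramPair L K :=
  ⟨h.right, h.left, h.covariogram_eq.symm⟩

lemma interior_sub_eq (h : IsCovariogramPair K L) :
    interior K - interior K = interior L - interior L := by
  ext x
  rw [← h.left.covariogram_ne_zero_iff, ← h.right.covariogram_ne_zero_iff, h.covariogram_eq]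

lemma overlapDomain_eq (h : IsCovariogramPair K L) : overlapDomain K = overlapDomain L := by
  ext x
  rw [mem_overlapDomain_iff, mem_overlapDomain_iff, h.interior_sub_eq]

lemma side_eq (h : IsCovariogramPair K L) {x : Plane} (hx : x ∈ overlapDomain K) :
    side K x = side L x := by
  have h1 := h.left.hasFDerivAt_covariogram hx
  have h2 := h.right.hasFDerivAt_covariogram (h.overlapDomain_eq ▸ hx)
  rw [h.covariogram_eq] at h1
  have h3 := h1.unique h2
  have h4 : quarterTurn (side K x) = quarterTurn (side L x) := by
    refine ext_inner_right ℝ fun v => ?_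
    rw [← innerSL_apply_apply ℝ, h3, innerSL_apply_apply]
  have a := congrArg (fun v : Plane => v 0) h4
  have b := congrArg (fun v : Plane => v 1) h4
  simp only [quarterTurn_zero_coord, quarterTurn_one_coord, neg_inj] at a b
  exact plane_ext b a

lemma sideDeriv_eq (h : IsCovariogramPair K L) {x : Plane} (hx : x ∈ overlapDomain K) :
    sideDeriv (nrm K x) = sideDeriv (nrm L x) := by
  have h1 := h.left.hasFDerivAt_side hx
  have h2 := h.right.hasFDerivAt_side (h.overlapDomain_eq ▸ hx)
  refine h1.unique (h2.congr_of_eventuallyEq ?_)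
  filter_upwards [(isOpen_overlapDomain K).mem_nhds hx] with y hy
  exact h.side_eq hy

/-- If the normals at opposite vertices are antipodal, the diagonal ends at a boundary point of
`K - K = L - L`, whose normal is also the normal of the other body. -/
lemma nrm_eq_of_antipodal (h : IsCovariogramPair K L) {x : Plane} (hx : x ∈ overlapDomain K)
    (ha : nrm K x 0 = -nrm K x 2) : nrm L x 0 = nrm K x 0 ∧ nrm L x 2 = nrm K x 2 := by
  have H := h.left.inscribed hx
  have H' := h.right.inscribed (h.overlapDomain_eq ▸ hx)
  have hs := h.side_eq hx
  have hdiag : vert K x 0 - vert K x 2 = vert L x 0 - vert L x 2 := by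
    have e1 : vert K x 0 - vert K x 2 = side K x + (vert K x 3 - vert K x 2) := by
      rw [side]; abel
    have e2 : vert L x 0 - vert L x 2 = side L x + (vert L x 3 - vert L x 2) := by
      rw [side]; abel
    rw [e1, e2, hs, ← H.bottom_edge, ← H'.bottom_edge]
  have hsup : ∀ y ∈ interior L - interior L,
      ⟪nrm K x 0, y⟫ ≤ ⟪nrm K x 0, vert L x 0 - vert L x 2⟫ := by
    rw [← h.interior_sub_eq, ← hdiag]
    rintro _ ⟨a, ha', b, hb, rfl⟩
    have h1 := H.normal 0 a (interior_subset ha')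
    have h2 := H.normal 2 b (interior_subset hb)
    rw [show nrm K x 2 = -nrm K x 0 by rw [ha, neg_neg], inner_neg_left, inner_neg_left] at h2
    rw [inner_sub_right, inner_sub_right]; linarith
  constructor
  · refine h.right.normal_unique (H'.mem_frontier 0) (H'.norm_normal 0) (H'.normal 0)
      (H.norm_normal 0) fun y hy => ?_
    have := h.right.inner_le_of_interior_sub hsup (Set.sub_mem_sub hy (H'.mem h.right 2))
    rw [inner_sub_right, inner_sub_right] at this; linarith
  · refine h.right.normal_unique (H'.mem_frontier 2) (H'.norm_normal 2) (H'.normal 2)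
      (H.norm_normal 2) fun y hy => ?_
    have := h.right.inner_le_of_interior_sub hsup (Set.sub_mem_sub (H'.mem h.right 0) hy)
    rw [inner_sub_right, inner_sub_right] at this
    rw [show nrm K x 2 = -nrm K x 0 by rw [ha, neg_neg], inner_neg_left, inner_neg_left]
    linarith

end IsCovariogramPair

/-! ### Algebraic consequences of equal derivatives -/

/-- When two projections agree at a vector perpendicular to `e`, they have the same range, and also
the same kernel unless that vector lies in the range. -/
lemma obliqueProj_quarterTurn_eq {a b a' b' e w : Plane} (ha : ‖a‖ = 1) (ha' : ‖a'‖ = 1)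
    (hw : 0 < ⟪a, w⟫) (hw' : 0 < ⟪a', w⟫) (hab : planeDet a b ≠ 0) (hab' : planeDet a' b' ≠ 0)
    (heb : planeDet e b ≠ 0)
    (h : obliqueProj a b (quarterTurn e) = obliqueProj a' b' (quarterTurn e)) :
    a = a' ∧ planeDet e a * planeDet b b' = 0 := by
  rw [obliqueProj_apply, obliqueProj_apply, inner_quarterTurn, inner_quarterTurn] at h
  have h0 := congrArg (fun v : Plane => v 0) h
  have h1 := congrArg (fun v : Plane => v 1) h
  simp only [PiLp.smul_apply, smul_eq_mul, quarterTurn_zero_coord, quarterTurn_one_coord]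
    at h0 h1
  have hc : planeDet e b / planeDet a b ≠ 0 := div_ne_zero heb hab
  have hdet : planeDet a a' = 0 := by
    have : planeDet e b / planeDet a b * planeDet a a' = 0 := by
      simp only [planeDet] at h0 h1 ⊢
      linear_combination a' 1 * h1 + a' 0 * h0
    exact (mul_eq_zero.1 this).resolve_left hc
  obtain rfl := unit_eq_of_planeDet_eq_zero ha ha' hdet hw hw'
  refine ⟨rfl, ?_⟩
  have hna := unit_coord ha
  have h2 : planeDet e b / planeDet a b = planeDet e b' / planeDet a b' := by
    linear_combination a 1 * (-h0) + a 0 * h1 - (planeDet e b / planeDet a b - planeDet e b' / planeDet a b') * hna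
  rw [div_eq_div_iff hab hab'] at h2
  simp only [planeDet] at h2 ⊢
  linear_combination h2

/-- The cross ratio of the four slopes is determined by the coefficients of the derivative of the edge
map. -/
lemma cross_ratio_eq {σ₀ σ₂ τ₁ τ₃ : ℝ} (p1 : 0 < σ₀ + τ₁) (p2 : 0 < σ₂ + τ₃) :
    (σ₀ + τ₃) / (σ₀ + τ₁) * ((σ₂ + τ₁) / (σ₂ + τ₃)) =
      (τ₁ / (σ₀ + τ₁) - σ₂ / (σ₂ + τ₃)) ^ 2 + (1 / (σ₀ + τ₁) + 1 / (σ₂ + τ₃)) *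
        (τ₁ * σ₀ / (σ₀ + τ₁) + σ₂ * τ₃ / (σ₂ + τ₃)) := by
  field_simp
  ring

/-- Let two sums of two rank one matrices be equal, so that the difference of the first summands is
minus that of the second ones. The two sides are the negatives of the determinants of these
differences. -/
lemma slopes_det_eq {σ₀ σ₂ τ₁ τ₃ s₀ s₂ t₁ t₃ α β a b : ℝ}
    (q1 : α * (σ₀ + τ₁) = 1) (q2 : β * (σ₂ + τ₃) = 1) (q3 : a * (s₀ + t₁) = 1)
    (q4 : b * (s₂ + t₃) = 1) (h1 : α + β = a + b)
    (h2 : τ₁ * α - σ₂ * β = t₁ * a - s₂ * b)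
    (h3 : τ₁ * σ₀ * α + σ₂ * τ₃ * β = t₁ * s₀ * a + s₂ * t₃ * b) :
    α * a * ((σ₀ - s₀) * (t₁ - τ₁)) = β * b * ((σ₂ - s₂) * (t₃ - τ₃)) := by
  have e1 : -(α * a * ((σ₀ - s₀) * (t₁ - τ₁))) =
      (τ₁ * α - t₁ * a) * (σ₀ * α - s₀ * a) - (α - a) * (σ₀ * τ₁ * α - s₀ * t₁ * a) := by
    ring
  have e2 : -(β * b * ((σ₂ - s₂) * (t₃ - τ₃))) =
      (σ₂ * β - s₂ * b) * (τ₃ * β - t₃ * b) - (β - b) * (σ₂ * τ₃ * β - s₂ * t₃ * b) := by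
    ring
  have r1 : σ₀ * α - s₀ * a = -(τ₁ * α - t₁ * a) := by linear_combination q1 - q3
  have r2 : τ₃ * β - t₃ * b = -(σ₂ * β - s₂ * b) := by linear_combination q2 - q4
  have r3 : τ₁ * α - t₁ * a = σ₂ * β - s₂ * b := by linear_combination h2
  have r4 : α - a = -(β - b) := by linear_combination h1
  have r5 : σ₀ * τ₁ * α - s₀ * t₁ * a = -(σ₂ * τ₃ * β - s₂ * t₃ * b) := by
    linear_combination h3
  rw [r1, r3, r4, r5] at e1
  rw [r2] at e2
  linear_combination e2 - e1

/-- Two quadruples of slopes giving the same derivative of the edge map cannot be nested: the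
derivative determines a cross ratio, which is strictly monotone under nesting. -/
lemma slopes_not_nested {σ₀ σ₂ τ₁ τ₃ s₀ s₂ t₁ t₃ : ℝ} (hτ₃ : 0 < τ₃)
    (hs₀ : 0 < s₀) (ht₃ : 0 < t₃)
    (h1 : 1 / (σ₀ + τ₁) + 1 / (σ₂ + τ₃) = 1 / (s₀ + t₁) + 1 / (s₂ + t₃))
    (h2 : τ₁ / (σ₀ + τ₁) - σ₂ / (σ₂ + τ₃) = t₁ / (s₀ + t₁) - s₂ / (s₂ + t₃))
    (h3 : τ₁ * σ₀ / (σ₀ + τ₁) + σ₂ * τ₃ / (σ₂ + τ₃) =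
      t₁ * s₀ / (s₀ + t₁) + s₂ * t₃ / (s₂ + t₃))
    (hs : s₀ < σ₀) (hσ : σ₀ < σ₂) (hs' : σ₂ < s₂) (hτ : τ₃ < τ₁) (ht : τ₁ < t₁) : False := by
  have p1 : 0 < σ₀ + τ₁ := by linarith
  have p2 : 0 < σ₂ + τ₃ := by linarith
  have p3 : 0 < s₀ + t₁ := by linarith
  have p4 : 0 < s₂ + t₃ := by linarith
  have X : (s₀ + t₃) / (s₀ + t₁) * ((s₂ + t₁) / (s₂ + t₃)) =
      (σ₀ + τ₃) / (σ₀ + τ₁) * ((σ₂ + τ₁) / (σ₂ + τ₃)) := by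
    rw [cross_ratio_eq p1 p2, cross_ratio_eq p3 p4, h1, h2, h3]
  have t3 : t₃ < τ₃ := by
    by_contra! hc
    have D := slopes_det_eq (inv_mul_cancel₀ p1.ne') (inv_mul_cancel₀ p2.ne')
      (inv_mul_cancel₀ p3.ne') (inv_mul_cancel₀ p4.ne')
      (by simpa only [div_eq_mul_inv, one_mul] using h1)
      (by simpa only [div_eq_mul_inv] using h2) (by simpa only [div_eq_mul_inv] using h3)
    have l1 : 0 < (σ₀ + τ₁)⁻¹ * (s₀ + t₁)⁻¹ * ((σ₀ - s₀) * (t₁ - τ₁)) :=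
      mul_pos (mul_pos (inv_pos.2 p1) (inv_pos.2 p3)) (mul_pos (by linarith) (by linarith))
    have l2 : (σ₂ + τ₃)⁻¹ * (s₂ + t₃)⁻¹ * ((σ₂ - s₂) * (t₃ - τ₃)) ≤ 0 :=
      mul_nonpos_of_nonneg_of_nonpos (mul_pos (inv_pos.2 p2) (inv_pos.2 p4)).le
        (mul_nonpos_of_nonpos_of_nonneg (by linarith) (by linarith))
    linarith
  have r1 : 0 < s₀ + τ₁ := by linarith
  have r2 : 0 < s₂ + τ₃ := by linarith
  have r3 : 0 < s₀ + τ₃ := by linarith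
  have r4 : 0 < s₂ + τ₁ := by linarith
  have i1 : (s₀ + τ₃) / (s₀ + τ₁) < (σ₀ + τ₃) / (σ₀ + τ₁) := by
    rw [div_lt_div_iff₀ r1 p1]
    linarith [mul_pos (sub_pos.2 hs) (sub_pos.2 hτ)]
  have i2 : (s₂ + τ₁) / (s₂ + τ₃) < (σ₂ + τ₁) / (σ₂ + τ₃) := by
    rw [div_lt_div_iff₀ r2 p2]
    linarith [mul_pos (sub_pos.2 hs') (sub_pos.2 hτ)]
  have i3 : (s₂ + t₁) / (s₀ + t₁) < (s₂ + τ₁) / (s₀ + τ₁) := by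
    rw [div_lt_div_iff₀ p3 r1]
    linarith [mul_pos (sub_pos.2 (hs.trans (hσ.trans hs'))) (sub_pos.2 ht)]
  have i4 : (s₀ + t₃) / (s₂ + t₃) < (s₀ + τ₃) / (s₂ + τ₃) := by
    rw [div_lt_div_iff₀ p4 r2]
    linarith [mul_pos (sub_pos.2 (hs.trans (hσ.trans hs'))) (sub_pos.2 t3)]
  have j1 := mul_lt_mul'' i1 i2 (div_pos r3 r1).le (div_pos r4 r2).le
  have j2 := mul_lt_mul'' i4 i3 (div_pos (by linarith) p4).le (div_pos (by linarith) p3).le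
  have c1 : (s₀ + τ₃) / (s₀ + τ₁) * ((s₂ + τ₁) / (s₂ + τ₃)) =
    (s₀ + τ₃) / (s₂ + τ₃) * ((s₂ + τ₁) / (s₀ + τ₁)) := by ring
  have c2 : (s₀ + t₃) / (s₀ + t₁) * ((s₂ + t₁) / (s₂ + t₃)) =
    (s₀ + t₃) / (s₂ + t₃) * ((s₂ + t₁) / (s₀ + t₁)) := by ring
  linarith

/-- The slope of a normal `w` in the coordinates given by the edges `x` and `d` of the inscribed
parallelogram. -/
def normalSlope (x d w : Plane) : ℝ := ⟪w, x⟫ / ⟪w, d⟫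

lemma normalSlope_sub {x d w w' : Plane} (h : ⟪w, d⟫ ≠ 0) (h' : ⟪w', d⟫ ≠ 0) :
    normalSlope x d w - normalSlope x d w' =
      planeDet w w' * planeDet x d / (⟪w, d⟫ * ⟪w', d⟫) := by
  rw [normalSlope, normalSlope, planeDet_mul_planeDet]
  field_simp

lemma normalSlope_lt {x d w w' : Plane} (hx : 0 < planeDet x d) (h : 0 < ⟪w, d⟫ * ⟪w', d⟫)
    (hw : 0 < planeDet w w') : normalSlope x d w' < normalSlope x d w := by
  have h1 : ⟪w, d⟫ ≠ 0 := left_ne_zero_of_mul h.ne'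
  have h2 : ⟪w', d⟫ ≠ 0 := right_ne_zero_of_mul h.ne'
  rw [← sub_pos, normalSlope_sub h1 h2]
  positivity

namespace IsInscribedParallelogram

variable {x : Plane} {p u q v : Fin 4 → Plane}

/-- The derivative of the edge map, in the basis of the two edges, in terms of slopes. -/
lemma planeDet_sideDeriv_slope (hK : IsSmoothBody K) (H : IsInscribedParallelogram K x p u)
    {d : Plane} (hd : d = p 0 - p 3) :
    planeDet (sideDeriv u d) d = -planeDet x d *
      (1 / (normalSlope x d (u 0) + -normalSlope x d (u 1)) +
        1 / (normalSlope x d (u 2) + -normalSlope x d (u 3))) ∧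
    planeDet (sideDeriv u x) d = planeDet x d *
      (-normalSlope x d (u 1) / (normalSlope x d (u 0) + -normalSlope x d (u 1)) -
        normalSlope x d (u 2) / (normalSlope x d (u 2) + -normalSlope x d (u 3))) ∧
    planeDet (sideDeriv u x) x = planeDet x d *
      (-normalSlope x d (u 1) * normalSlope x d (u 0) /
          (normalSlope x d (u 0) + -normalSlope x d (u 1)) +
        normalSlope x d (u 2) * -normalSlope x d (u 3) /
          (normalSlope x d (u 2) + -normalSlope x d (u 3))) := by
  have A0 := (H.inner_zero_side_pos hK).ne'
  have A1 := (H.inner_one_side_pos hK).ne'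
  have A2 := (H.inner_two_side_neg hK).ne
  have A3 := (H.inner_three_side_neg hK).ne
  have D := H.planeDet_pos.ne'
  rw [← hd] at A0 A1 A2 A3 D
  have B1 := (H.planeDet_zero_one_pos hK).ne'
  have B2 := (H.planeDet_two_three_pos hK).ne'
  have e1 : normalSlope x d (u 0) + -normalSlope x d (u 1) = _ :=
    (sub_eq_add_neg _ _).symm.trans (normalSlope_sub A0 A1)
  have e2 : normalSlope x d (u 2) + -normalSlope x d (u 3) = _ :=
    (sub_eq_add_neg _ _).symm.trans (normalSlope_sub A2 A3)
  rw [e1, e2, planeDet_sideDeriv, planeDet_sideDeriv, planeDet_sideDeriv, planeDet_swap (u 3) (u 2)]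
  simp only [normalSlope]
  refine ⟨?_, ?_, ?_⟩
  · field_simp
    ring
  · field_simp
    ring
  · field_simp
    ring

/-- The slopes of the normals of two bodies whose edge maps agree to first order are not nested. -/
lemma not_nested (hK : IsSmoothBody K) (hL : IsSmoothBody L)
    (H : IsInscribedParallelogram K x p u) (H' : IsInscribedParallelogram L x q v)
    (hD : p 0 - p 3 = q 0 - q 3) (hM : sideDeriv u = sideDeriv v)
    (h00 : 0 < planeDet (u 0) (v 0)) (h20 : 0 < planeDet (-u 2) (u 0))
    (h22 : 0 < planeDet (v 2) (u 2)) (h13 : 0 < planeDet (u 1) (u 3))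
    (h11 : 0 < planeDet (u 1) (v 1)) : False := by
  obtain ⟨d, hd⟩ : ∃ d, d = p 0 - p 3 := ⟨_, rfl⟩
  have A0 := H.inner_zero_side_pos hK
  have A1 := H.inner_one_side_pos hK
  have A2 := H.inner_two_side_neg hK
  have A3 := H.inner_three_side_neg hK
  have D := H.planeDet_pos
  have A0' := H'.inner_zero_side_pos hL
  have A1' := H'.inner_one_side_pos hL
  have A2' := H'.inner_two_side_neg hL
  have A3' := H'.inner_three_side_neg hL
  rw [← hD] at A0' A1' A2' A3'
  rw [← hd] at A0 A1 A2 A3 D A0' A1' A2' A3'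
  have X3 := H.inner_three_pos hK
  have X0' := H'.inner_zero_pos hL
  have X3' := H'.inner_three_pos hL
  obtain ⟨k1, k2, k3⟩ := H.planeDet_sideDeriv_slope hK hd
  obtain ⟨l1, l2, l3⟩ := H'.planeDet_sideDeriv_slope hL (hd.trans hD)
  rw [hM, l1] at k1
  rw [hM, l2] at k2
  rw [hM, l3] at k3
  have m20 : 0 < planeDet (u 0) (u 2) := by
    simp only [planeDet, PiLp.neg_apply] at h20 ⊢; linarith
  refine slopes_not_nested (σ₀ := normalSlope x d (u 0)) (σ₂ := normalSlope x d (u 2))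
    (τ₁ := -normalSlope x d (u 1)) (τ₃ := -normalSlope x d (u 3))
    (s₀ := normalSlope x d (v 0)) (s₂ := normalSlope x d (v 2))
    (t₁ := -normalSlope x d (v 1)) (t₃ := -normalSlope x d (v 3))
    (neg_pos.2 (div_neg_of_pos_of_neg X3 A3)) (div_pos X0' A0')
    (neg_pos.2 (div_neg_of_pos_of_neg X3' A3'))
    (mul_left_cancel₀ (neg_ne_zero.2 D.ne') k1).symm (mul_left_cancel₀ D.ne' k2).symm
    (mul_left_cancel₀ D.ne' k3).symm ?_ ?_ ?_ ?_ ?_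
  · exact normalSlope_lt D (mul_pos A0 A0') h00
  · rw [← sub_pos, ← neg_sub, normalSlope_sub A0.ne' A2.ne, ← neg_div]
    exact div_pos_of_neg_of_neg (neg_neg_of_pos (mul_pos m20 D)) (mul_neg_of_pos_of_neg A0 A2)
  · exact normalSlope_lt D (mul_pos_of_neg_of_neg A2' A2) h22
  · rw [← sub_pos, neg_sub_neg, ← neg_sub, normalSlope_sub A1.ne' A3.ne, ← neg_div]
    exact div_pos_of_neg_of_neg (neg_neg_of_pos (mul_pos h13 D)) (mul_neg_of_pos_of_neg A1 A3)
  · exact neg_lt_neg (normalSlope_lt D (mul_pos A1 A1') h11)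

end IsInscribedParallelogram

/-! ### Moving the parallelogram -/

namespace IsSmoothBody

lemma vert_eq (hK : IsSmoothBody K) {x : Plane} {p u : Fin 4 → Plane}
    (H : IsInscribedParallelogram K x p u) : vert K x = p :=
  (hK.inscribed_unique (hK.inscribed (H.mem_overlapDomain hK)) H).1

/-- The only chords of `K` parallel and congruent to `x` are two sides of the inscribed
parallelogram. -/
lemma chord_eq (hK : IsSmoothBody K) {x a b : Plane} (hx : x ∈ overlapDomain K)
    (ha : a ∈ frontier K) (hb : b ∈ frontier K) (hab : a - b = x) :
    a = vert K x 0 ∨ a = vert K x 3 := by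
  have H := hK.inscribed hx
  obtain ⟨m, hm, hmn⟩ := hK.exists_normal ha
  obtain ⟨n, hn, hnn⟩ := hK.exists_normal hb
  have hbx : b = a - x := by rw [← hab]; abel
  have e1 : vert K x 1 = vert K x 0 - x := by nth_rw 3 [H.top_edge]; abel
  have e2 : vert K x 2 = vert K x 3 - x := by nth_rw 3 [H.bottom_edge]; abel
  have hle := H.planeDet_sub_zero_nonpos hK (hK.frontier_subset ha)
    (by rw [← hbx]; exact hK.frontier_subset hb)
  rcases hle.lt_or_eq with h | h
  · right
    have hpos : 0 < planeDet x (vert K x 0 - a) := by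
      simp only [planeDet, PiLp.sub_apply] at h ⊢; linarith
    have H' : IsInscribedParallelogram K x ![vert K x 0, vert K x 1, b, a]
        ![nrm K x 0, nrm K x 1, n, m] := by
      refine ⟨?_, isCounterclockwise_of_parallelogram e1 hbx hpos, H.top_edge, hab.symm, ?_, ?_⟩
      · intro i; fin_cases i
        exacts [H.mem_frontier 0, H.mem_frontier 1, hb, ha]
      · intro i; fin_cases i
        exacts [H.norm_normal 0, H.norm_normal 1, hn, hm]
      · intro i; fin_cases i
        exacts [H.normal 0, H.normal 1, hnn, hmn]
    exact (congrFun (hK.vert_eq H') 3).symm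
  · left
    have hpos : 0 < planeDet x (a - vert K x 3) := by
      have := H.planeDet_pos
      simp only [planeDet, PiLp.sub_apply] at h this ⊢; linarith
    have H' : IsInscribedParallelogram K x ![a, b, vert K x 2, vert K x 3]
        ![m, n, nrm K x 2, nrm K x 3] := by
      refine ⟨?_, isCounterclockwise_of_parallelogram hbx e2 hpos, hab.symm, H.bottom_edge, ?_, ?_⟩
      · intro i; fin_cases i
        exacts [ha, hb, H.mem_frontier 2, H.mem_frontier 3]
      · intro i; fin_cases i
        exacts [hm, hn, H.norm_normal 2, H.norm_normal 3]
      · intro i; fin_cases i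
        exacts [hmn, hnn, H.normal 2, H.normal 3]
    exact (congrFun (hK.vert_eq H') 0).symm

lemma hasFDerivAt_vert_one (hK : IsSmoothBody K) {x : Plane} (hx : x ∈ overlapDomain K) :
    HasFDerivAt (fun y => vert K y 1)
      (obliqueProj (nrm K x 0) (nrm K x 1) - ContinuousLinearMap.id ℝ Plane) x := by
  refine ((hK.hasFDerivAt_vert_zero hx).sub (hasFDerivAt_id x)).congr_of_eventuallyEq ?_
  filter_upwards [(isOpen_overlapDomain K).mem_nhds hx] with y hy
  have := (hK.inscribed hy).top_edge
  change vert K y 1 = vert K y 0 - y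
  nth_rw 3 [this]; abel

end IsSmoothBody

lemma HasDerivAt.tendsto_right {y : ℝ → Plane} {h x : Plane} (hy : HasDerivAt y h 0)
    (h0 : y 0 = x) : Filter.Tendsto y (nhdsWithin 0 (Set.Ioi 0)) (nhds x) := by
  have := hy.continuousAt.tendsto
  rw [h0] at this
  exact this.mono_left nhdsWithin_le_nhds

lemma HasDerivAt.eventually_pos {f : ℝ → ℝ} {c : ℝ} (hf : HasDerivAt f c 0) (h0 : f 0 = 0)
    (hc : 0 < c) : ∀ᶠ s in nhdsWithin 0 (Set.Ioi 0), 0 < f s := by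
  filter_upwards [hf.tendsto_slope_zero_right.eventually_const_lt hc, self_mem_nhdsWithin]
    with s hs hs0
  rw [zero_add, h0, sub_zero, smul_eq_mul] at hs
  exact pos_of_mul_pos_right hs (inv_pos.2 hs0).le

namespace IsSmoothBody

variable {x h : Plane} {y : ℝ → Plane}

lemma eventually_mem (hx : x ∈ overlapDomain K) (hy : HasDerivAt y h 0) (h0 : y 0 = x) :
    ∀ᶠ s in nhdsWithin 0 (Set.Ioi 0), y s ∈ overlapDomain K :=
  (hy.tendsto_right h0).eventually ((isOpen_overlapDomain K).mem_nhds hx)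

lemma tendsto_nrm (hK : IsSmoothBody K) (hx : x ∈ overlapDomain K) (hy : HasDerivAt y h 0)
    (h0 : y 0 = x) (i : Fin 4) :
    Filter.Tendsto (fun s => nrm K (y s) i) (nhdsWithin 0 (Set.Ioi 0)) (nhds (nrm K x i)) :=
  (hK.continuousAt_nrm hx i).tendsto.comp (hy.tendsto_right h0)

/-- The normal at a vertex turns in the direction in which the vertex moves along the boundary. -/
lemma eventually_turn (hK : IsSmoothBody K) (hx : x ∈ overlapDomain K)
    (hy : HasDerivAt y h 0) (h0 : y 0 = x) {i : Fin 4} {A : Plane →L[ℝ] Plane}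
    (hA : HasFDerivAt (fun z => vert K z i) A x) {ε : ℝ}
    (hε : 0 < ε * ⟪quarterTurn (nrm K x i), A h⟫) :
    ∀ᶠ s in nhdsWithin 0 (Set.Ioi 0), 0 < ε * planeDet (nrm K x i) (nrm K (y s) i) := by
  have H := hK.inscribed hx
  have hv : HasDerivAt (fun s => vert K (y s) i - vert K x i) (A h) 0 :=
    (hA.comp_hasDerivAt_of_eq 0 hy h0.symm).sub_const _
  have hf : HasDerivAt (fun s => ε * ⟪quarterTurn (nrm K x i), vert K (y s) i - vert K x i⟫)
      (ε * ⟪quarterTurn (nrm K x i), A h⟫) 0 :=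
    (((innerSL ℝ (quarterTurn (nrm K x i))).hasFDerivAt.comp_hasDerivAt 0 hv)).const_mul ε
  have hin : Filter.Tendsto (fun s => ⟪nrm K x i, nrm K (y s) i⟫) (nhdsWithin 0 (Set.Ioi 0))
      (nhds 1) := by
    have := (tendsto_const_nhds (x := nrm K x i)).inner (𝕜 := ℝ) (hK.tendsto_nrm hx hy h0 i)
    rwa [real_inner_self_eq_norm_sq, H.norm_normal, one_pow] at this
  filter_upwards [hf.eventually_pos (by rw [h0, sub_self, inner_zero_right, mul_zero]) hε,
    eventually_mem hx hy h0, hin.eventually_const_lt zero_lt_one] with s hs hsx hsin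
  have H' := hK.inscribed hsx
  have hne : vert K (y s) i ≠ vert K x i := by
    intro hc
    rw [hc, sub_self, inner_zero_right, mul_zero] at hs
    exact hs.false
  have h1 := (H.normal i).lt hK (H.norm_normal i) (H.mem hK i) (H'.mem hK i) hne
  have h2 := H'.normal i _ (H.mem hK i)
  set v := nrm K x i
  set v' := nrm K (y s) i
  set w := vert K (y s) i - vert K x i with hw
  have h1' : ⟪v, w⟫ < 0 := by rw [hw, inner_sub_right]; linarith
  have h2' : 0 ≤ ⟪v', w⟫ := by rw [hw, inner_sub_right]; linarith
  have huv := unit_coord (H.norm_normal i)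
  have key : ⟪v', w⟫ = ⟪v, v'⟫ * ⟪v, w⟫ + planeDet v v' * ⟪quarterTurn v, w⟫ := by
    simp only [plane_inner_eq, planeDet, quarterTurn_zero_coord, quarterTurn_one_coord]
    linear_combination (-(v' 0 * w 0 + v' 1 * w 1)) * huv
  have h3 : 0 < planeDet v v' * ⟪quarterTurn v, w⟫ := by
    have := mul_neg_of_pos_of_neg hsin h1'
    linarith
  have hε0 : ε ≠ 0 := by rintro rfl; simp at hε
  have h4 : 0 < (ε * planeDet v v') * (ε * ⟪quarterTurn v, w⟫) := by
    have : (ε * planeDet v v') * (ε * ⟪quarterTurn v, w⟫) =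
      ε ^ 2 * (planeDet v v' * ⟪quarterTurn v, w⟫) := by ring
    rw [this]; positivity
  exact pos_of_mul_pos_left h4 hs.le

/-- Moving the endpoints of the chord `p 0 - p 1` along the boundary moves the inscribed
parallelogram so that this chord remains its upper side. -/
lemma eventually_vert_eq (hK : IsSmoothBody K) (hx : x ∈ overlapDomain K)
    (hy : HasDerivAt y h 0) (h0 : y 0 = x) {a b : ℝ → Plane}
    (ha : Filter.Tendsto a (nhdsWithin 0 (Set.Ioi 0)) (nhds (vert K x 0)))
    (haf : ∀ᶠ s in nhdsWithin 0 (Set.Ioi 0), a s ∈ frontier K)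
    (hbf : ∀ᶠ s in nhdsWithin 0 (Set.Ioi 0), b s ∈ frontier K)
    (hab : ∀ s, a s - b s = y s) :
    ∀ᶠ s in nhdsWithin 0 (Set.Ioi 0), vert K (y s) 0 = a s ∧ vert K (y s) 1 = b s := by
  have hne := (ha.sub ((hK.continuousAt_vert hx 3).tendsto.comp (hy.tendsto_right h0))).eventually_ne
    (hK.inscribed hx).side_ne_zero
  filter_upwards [hne, haf, hbf, eventually_mem hx hy h0] with s h1 h2 h3 h4
  have e : vert K (y s) 0 = a s := by
    rcases hK.chord_eq h4 h2 h3 (hab s) with h5 | h5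
    · exact h5.symm
    · exact absurd (sub_eq_zero.2 h5) h1
  refine ⟨e, ?_⟩
  have h6 := (hK.inscribed h4).top_edge
  rw [e] at h6
  exact sub_right_injective (h6.symm.trans (hab s).symm)

lemma nrm_eq_of_vert_eq (hK : IsSmoothBody K) {x' : Plane} (hx : x ∈ overlapDomain K)
    (hx' : x' ∈ overlapDomain K) {i : Fin 4} (h : vert K x' i = vert K x i) :
    nrm K x' i = nrm K x i := by
  have H := hK.inscribed hx
  have H' := hK.inscribed hx'
  refine hK.normal_unique (H.mem_frontier i) (H'.norm_normal i) ?_ (H.norm_normal i) (H.normal i)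
  rw [← h]; exact H'.normal i

end IsSmoothBody

/-! ### The angle between corresponding normals has no interior extremum -/

lemma inner_lt_of_turn {u v v' : Plane} (hv : ‖v‖ = 1) (hv' : ‖v'‖ = 1) (h : 0 < planeDet v v')
    (h1 : 0 < planeDet u v) (h2 : 0 < planeDet u v') : ⟪u, v'⟫ < ⟪u, v⟫ := by
  have e : (1 + ⟪v, v'⟫) * (⟪u, v⟫ - ⟪u, v'⟫) =
      planeDet v v' * (planeDet u v + planeDet u v') := by
    have a := unit_coord hv
    have b := unit_coord hv'
    simp only [plane_inner_eq, planeDet]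
    linear_combination (u 0 * v' 0 + u 1 * v' 1) * a - (u 0 * v 0 + u 1 * v 1) * b
  have hc : 0 ≤ 1 + ⟪v, v'⟫ := by
    have := abs_real_inner_le_norm v v'
    rw [hv, hv', one_mul, abs_le] at this
    linarith
  have : 0 < (1 + ⟪v, v'⟫) * (⟪u, v⟫ - ⟪u, v'⟫) := by rw [e]; positivity
  exact sub_pos.1 (pos_of_mul_pos_right this hc)

/-- Vectors `x` for which the counterclockwise turn from the normal at the vertex `0` to the normal at
the vertex `2` is less than a half turn, for both bodies. -/
def turnDomain (K L : Set Plane) : Set Plane :=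
  {x | x ∈ overlapDomain K ∧ 0 < planeDet (-nrm K x 2) (nrm K x 0) ∧
    0 < planeDet (-nrm L x 2) (nrm L x 0)}

lemma hasDerivAt_line (x h : Plane) : HasDerivAt (fun s : ℝ => x + s • h) h 0 := by
  simpa using ((hasDerivAt_id (0 : ℝ)).smul_const h).const_add x

namespace IsCovariogramPair

variable {x h : Plane} {y : ℝ → Plane}

lemma eventually_mem_turnDomain (hP : IsCovariogramPair K L) (hx : x ∈ turnDomain K L)
    (hy : HasDerivAt y h 0) (h0 : y 0 = x) :
    ∀ᶠ s in nhdsWithin 0 (Set.Ioi 0), y s ∈ turnDomain K L := by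
  obtain ⟨hxO, h1, h2⟩ := hx
  have hxL : x ∈ overlapDomain L := hP.overlapDomain_eq ▸ hxO
  have t1 := (hP.left.tendsto_nrm hxO hy h0 2).neg.planeDet (hP.left.tendsto_nrm hxO hy h0 0)
  have t2 := (hP.right.tendsto_nrm hxL hy h0 2).neg.planeDet (hP.right.tendsto_nrm hxL hy h0 0)
  filter_upwards [IsSmoothBody.eventually_mem hxO hy h0, t1.eventually_const_lt h1,
    t2.eventually_const_lt h2] with s a b c using ⟨a, b, c⟩

/-- Suppose the normal of `L` at the vertex `0` is ahead of that of `K`. If the normals at the vertices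
`1` differ, one can keep the vertex `0` of the parallelogram in `K` and move the vertex `1` so that
the normal of `L` at the vertex `0` turns further away. -/
lemma nrm_one_eq_of_min (hP : IsCovariogramPair K L) (hx : x ∈ turnDomain K L)
    (h00 : 0 < planeDet (nrm K x 0) (nrm L x 0))
    (hmin : ∀ z ∈ turnDomain K L, ⟪nrm K x 0, nrm L x 0⟫ ≤ ⟪nrm K z 0, nrm L z 0⟫) :
    nrm K x 1 = nrm L x 1 := by
  have hxK := hx.1
  have hxL : x ∈ overlapDomain L := hP.overlapDomain_eq ▸ hxK
  have H := hP.left.inscribed hxK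
  have H' := hP.right.inscribed hxL
  by_contra hne
  have hdet : planeDet (nrm K x 1) (nrm L x 1) ≠ 0 := fun hd => hne <|
    unit_eq_of_planeDet_eq_zero (H.norm_normal 1) (H'.norm_normal 1) hd
      (w := -x) (by rw [inner_neg_right]; exact neg_pos.2 (H.inner_one_neg hP.left))
      (by rw [inner_neg_right]; exact neg_pos.2 (H'.inner_one_neg hP.right))
  obtain ⟨h, hu1, hv1⟩ : ∃ h, ⟪nrm K x 1, h⟫ = 0 ∧ 0 < ⟪nrm L x 1, h⟫ := by
    refine ⟨planeDet (nrm K x 1) (nrm L x 1) • quarterTurn (nrm K x 1), ?_, ?_⟩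
    · rw [inner_smul_right, inner_quarterTurn]; simp only [planeDet]; ring
    · rw [inner_smul_right, inner_quarterTurn]; exact mul_self_pos.2 hdet
  have hl := hasDerivAt_line x h
  have hl0 : x + (0 : ℝ) • h = x := by simp
  obtain ⟨y, hyd⟩ : ∃ y : ℝ → Plane, y = fun s => vert K x 0 - vert K (x + s • h) 1 := ⟨_, rfl⟩
  have hy : HasDerivAt y h 0 := by
    have h1 := ((hP.left.hasFDerivAt_vert_one hxK).comp_hasDerivAt_of_eq 0 hl hl0.symm).const_sub
      (vert K x 0)
    rw [hyd]
    refine h1.congr_deriv ?_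
    simp [obliqueProj_apply, hu1]
  have hy0 : y 0 = x := by rw [hyd]; simp only [hl0]; exact H.top_edge.symm
  have hvert := hP.left.eventually_vert_eq hxK hy hy0 (a := fun _ => vert K x 0)
    (b := fun s => vert K (x + s • h) 1) tendsto_const_nhds
    (Filter.Eventually.of_forall fun _ => H.mem_frontier 0)
    ((IsSmoothBody.eventually_mem hxK hl hl0).mono fun s hs =>
      (hP.left.inscribed hs).mem_frontier 1)
    (fun s => by rw [hyd])
  have hturn := hP.right.eventually_turn hxL hy hy0 (hP.right.hasFDerivAt_vert_zero hxL) (ε := 1)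
    (by
      rw [obliqueProj_apply, inner_smul_right, real_inner_self_eq_norm_sq, norm_quarterTurn,
        H'.norm_normal, one_mul, one_pow, mul_one]
      exact div_pos hv1 (H'.planeDet_zero_one_pos hP.right))
  have hcont := ((tendsto_const_nhds (x := nrm K x 0)).planeDet
    (hP.right.tendsto_nrm hxL hy hy0 0)).eventually_const_lt h00
  obtain ⟨s, ⟨hs1, -⟩, hs2, hs3, hs4⟩ := (hvert.and (hturn.and (hcont.and
    (hP.eventually_mem_turnDomain hx hy hy0)))).exists
  have hn := hP.left.nrm_eq_of_vert_eq hxK hs4.1 hs1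
  have hm := hmin _ hs4
  rw [hn] at hm
  rw [one_mul] at hs2
  have hsL : y s ∈ overlapDomain L := hP.overlapDomain_eq ▸ hs4.1
  exact absurd hm (not_le.2 (inner_lt_of_turn (H'.norm_normal 0)
    ((hP.right.inscribed hsL).norm_normal 0) hs2 h00 hs3))

/-- If the normals at the vertices `1` coincide, the derivatives of the edge maps in the direction of
the common tangent only involve the normals at the vertices `2` and `3`. -/
lemma normals_of_nrm_one_eq (hP : IsCovariogramPair K L) (hx : x ∈ turnDomain K L)
    (h00 : 0 < planeDet (nrm K x 0) (nrm L x 0)) (h11 : nrm K x 1 = nrm L x 1) :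
    nrm K x 3 = -nrm K x 1 ∧ 0 < planeDet (nrm L x 2) (nrm K x 2) := by
  have hxK := hx.1
  have hxL : x ∈ overlapDomain L := hP.overlapDomain_eq ▸ hxK
  have H := hP.left.inscribed hxK
  have H' := hP.right.inscribed hxL
  have hM := hP.sideDeriv_eq hxK
  have hself : ⟪nrm K x 1, quarterTurn (nrm K x 1)⟫ = 0 := by
    rw [inner_quarterTurn]; simp only [planeDet]; ring
  have h32 : planeDet (nrm K x 3) (nrm K x 2) < 0 := by
    rw [planeDet_swap]; exact neg_neg_of_pos (H.planeDet_two_three_pos hP.left)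
  have h32' : planeDet (nrm L x 3) (nrm L x 2) < 0 := by
    rw [planeDet_swap]; exact neg_neg_of_pos (H'.planeDet_two_three_pos hP.right)
  have hE : obliqueProj (nrm K x 3) (nrm K x 2) (quarterTurn (nrm K x 1)) =
      obliqueProj (nrm L x 3) (nrm L x 2) (quarterTurn (nrm K x 1)) := by
    have := congrArg (fun T : Plane →L[ℝ] Plane => T (quarterTurn (nrm K x 1))) hM
    simp only [sideDeriv, sub_apply, obliqueProj_apply, hself, ← h11,
      zero_div, zero_smul, zero_sub, neg_inj] at this ⊢
    exact this
  obtain ⟨h33, hprod⟩ := obliqueProj_quarterTurn_eq (H.norm_normal 3) (H'.norm_normal 3)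
    (H.inner_three_pos hP.left) (H'.inner_three_pos hP.right) h32.ne h32'.ne
    (H.planeDet_one_two_pos hP.left).ne' hE
  have h13 : nrm K x 3 = -nrm K x 1 := by
    rcases mul_eq_zero.1 hprod with h | h
    · refine unit_eq_of_planeDet_eq_zero (H.norm_normal 3)
        (by rw [norm_neg]; exact H.norm_normal 1) ?_ (H.inner_three_pos hP.left)
        (by rw [inner_neg_left]; exact neg_pos.2 (H.inner_one_neg hP.left))
      simp only [planeDet, PiLp.neg_apply] at h ⊢; linarith
    · -- all normals except those at the vertices `0` would agree, hence these as well
      exfalso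
      have h22 : nrm K x 2 = nrm L x 2 := unit_eq_of_planeDet_eq_zero (H.norm_normal 2)
        (H'.norm_normal 2) h (w := -x)
        (by rw [inner_neg_right]; exact neg_pos.2 (H.inner_two_neg hP.left))
        (by rw [inner_neg_right]; exact neg_pos.2 (H'.inner_two_neg hP.right))
      have h4 : obliqueProj (nrm K x 0) (nrm K x 1) (quarterTurn (nrm K x 2)) =
          obliqueProj (nrm L x 0) (nrm L x 1) (quarterTurn (nrm K x 2)) := by
        have := congrArg (fun T : Plane →L[ℝ] Plane => T (quarterTurn (nrm K x 2))) hM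
        simpa only [sideDeriv, sub_apply, ← h33, ← h22, sub_left_inj] using this
      have h5 := (obliqueProj_quarterTurn_eq (H.norm_normal 0) (H'.norm_normal 0)
        (H.inner_zero_pos hP.left) (H'.inner_zero_pos hP.right)
        (H.planeDet_zero_one_pos hP.left).ne' (H'.planeDet_zero_one_pos hP.right).ne'
        (by rw [planeDet_swap]; exact (neg_neg_of_pos (H.planeDet_one_two_pos hP.left)).ne) h4).1
      rw [h5] at h00
      simp [planeDet, mul_comm] at h00
  refine ⟨h13, ?_⟩
  -- compare the quadratic forms of the two derivatives at the common normal `nrm K x 1`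
  have hq := congrArg (fun T : Plane →L[ℝ] Plane => planeDet (T (nrm K x 1)) (nrm K x 1)) hM
  simp only [planeDet_sideDeriv, ← h33, ← h11, h13] at hq
  have hee : ⟪nrm K x 1, nrm K x 1⟫ = 1 := by
    rw [real_inner_self_eq_norm_sq, H.norm_normal, one_pow]
  have d0 := H.planeDet_zero_one_pos hP.left
  have d0' := H'.planeDet_zero_one_pos hP.right
  have d2 := H.planeDet_one_two_pos hP.left
  have d2' := H'.planeDet_one_two_pos hP.right
  rw [← h11] at d0' d2'
  have hneg : ∀ w, planeDet (-nrm K x 1) w = -planeDet (nrm K x 1) w := fun w => by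
    simp only [planeDet, PiLp.neg_apply]; ring
  rw [hneg, hneg, inner_neg_left, hee, one_mul, one_mul, mul_neg_one, mul_neg_one, neg_div_neg_eq,
    neg_div_neg_eq] at hq
  have ident : ∀ a b : Plane, ⟪a, nrm K x 1⟫ * planeDet b (nrm K x 1) -
      ⟪b, nrm K x 1⟫ * planeDet a (nrm K x 1) = -planeDet a b := fun a b => by
    have := unit_coord (H.norm_normal 1)
    simp only [planeDet, plane_inner_eq]
    linear_combination (-(a 0 * b 1 - a 1 * b 0)) * this
  have i0 := ident (nrm K x 0) (nrm L x 0)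
  have i2 := ident (nrm K x 2) (nrm L x 2)
  rw [planeDet_swap (nrm L x 2) (nrm K x 1), planeDet_swap (nrm K x 2) (nrm K x 1)] at i2
  have c0 : ⟪nrm K x 0, nrm K x 1⟫ / planeDet (nrm K x 0) (nrm K x 1) -
      ⟪nrm L x 0, nrm K x 1⟫ / planeDet (nrm L x 0) (nrm K x 1) < 0 := by
    rw [div_sub_div _ _ d0.ne' d0'.ne', mul_comm (planeDet (nrm K x 0) (nrm K x 1)), i0]
    exact div_neg_of_neg_of_pos (neg_neg_of_pos h00) (mul_pos d0 d0')
  have c2 : ⟪nrm K x 2, nrm K x 1⟫ / planeDet (nrm K x 1) (nrm K x 2) -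
      ⟪nrm L x 2, nrm K x 1⟫ / planeDet (nrm K x 1) (nrm L x 2) < 0 := by linarith
  rw [div_sub_div _ _ d2.ne' d2'.ne'] at c2
  have c3 := mul_neg_of_neg_of_pos c2 (mul_pos d2 d2')
  rw [div_mul_cancel₀ _ (mul_pos d2 d2').ne'] at c3
  rw [planeDet_swap]
  linarith

/-- The angle between the normals at the vertices `0` has no interior maximum: keeping the vertex `1` of
the parallelogram in `K` and moving the vertex `0` would lead to nested slopes. -/
lemma not_isMin_of_pos (hP : IsCovariogramPair K L) (hx : x ∈ turnDomain K L)
    (h00 : 0 < planeDet (nrm K x 0) (nrm L x 0))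
    (hmin : ∀ z ∈ turnDomain K L, ⟪nrm K x 0, nrm L x 0⟫ ≤ ⟪nrm K z 0, nrm L z 0⟫) : False := by
  have hxK := hx.1
  have hxL : x ∈ overlapDomain L := hP.overlapDomain_eq ▸ hxK
  have H := hP.left.inscribed hxK
  have H' := hP.right.inscribed hxL
  have h11 := hP.nrm_one_eq_of_min hx h00 hmin
  obtain ⟨h31, h22⟩ := hP.normals_of_nrm_one_eq hx h00 h11
  have d0 := H.planeDet_zero_one_pos hP.left
  have d0' := H'.planeDet_zero_one_pos hP.right
  obtain ⟨h, hh⟩ : ∃ h, h = quarterTurn (nrm K x 0) := ⟨_, rfl⟩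
  have hl := hasDerivAt_line x h
  have hl0 : x + (0 : ℝ) • h = x := by simp
  obtain ⟨y, hyd⟩ : ∃ y : ℝ → Plane, y = fun s => vert K (x + s • h) 0 - vert K x 1 := ⟨_, rfl⟩
  have hy : HasDerivAt y h 0 := by
    have h1 := ((hP.left.hasFDerivAt_vert_zero hxK).comp_hasDerivAt_of_eq 0 hl hl0.symm).sub_const
      (vert K x 1)
    rw [hyd]
    refine h1.congr_deriv ?_
    rw [obliqueProj_apply, hh, inner_quarterTurn, div_self d0.ne', one_smul]
  have hy0 : y 0 = x := by rw [hyd]; simp only [hl0]; exact H.top_edge.symm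
  have hta : Filter.Tendsto (fun s : ℝ => vert K (x + s • h) 0) (nhdsWithin 0 (Set.Ioi 0))
      (nhds (vert K x 0)) :=
    (hP.left.continuousAt_vert hxK 0).tendsto.comp (hl.tendsto_right hl0)
  have hvert := hP.left.eventually_vert_eq hxK hy hy0
    (b := fun _ => vert K x 1) hta
    ((IsSmoothBody.eventually_mem hxK hl hl0).mono fun s hs =>
      (hP.left.inscribed hs).mem_frontier 0)
    (Filter.Eventually.of_forall fun _ => H.mem_frontier 1)
    (fun s => by rw [hyd])
  have hturn3 := hP.left.eventually_turn hxK hy hy0 (hP.left.hasFDerivAt_vert_three hxK) (ε := -1)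
    (by
      rw [obliqueProj_apply, inner_smul_right, real_inner_self_eq_norm_sq, norm_quarterTurn,
        H.norm_normal, one_pow, mul_one, neg_one_mul, neg_pos, hh, inner_quarterTurn,
        planeDet_swap (nrm K x 3)]
      refine div_neg_of_pos_of_neg ?_ (neg_neg_of_pos (H.planeDet_two_three_pos hP.left))
      have := hx.2.1
      simp only [planeDet, PiLp.neg_apply] at this ⊢; linarith)
  have hturn1 := hP.right.eventually_turn hxL hy hy0 (hP.right.hasFDerivAt_vert_one hxL) (ε := 1)
    (by
      rw [sub_apply, ContinuousLinearMap.id_apply, obliqueProj_sub_self d0'.ne', inner_smul_right,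
        real_inner_self_eq_norm_sq, norm_quarterTurn, H'.norm_normal, one_mul, one_pow, mul_one,
        hh, inner_quarterTurn]
      exact div_pos h00 d0')
  have hc0 := ((hP.left.tendsto_nrm hxK hy hy0 0).planeDet
    (hP.right.tendsto_nrm hxL hy hy0 0)).eventually_const_lt h00
  have hc2 := ((hP.right.tendsto_nrm hxL hy hy0 2).planeDet
    (hP.left.tendsto_nrm hxK hy hy0 2)).eventually_const_lt h22
  obtain ⟨s, ⟨-, hs1⟩, hs3, ht1, hs0, hs2, hsV⟩ := (hvert.and (hturn3.and (hturn1.and (hc0.and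
    (hc2.and (hP.eventually_mem_turnDomain hx hy hy0)))))).exists
  have hsL : y s ∈ overlapDomain L := hP.overlapDomain_eq ▸ hsV.1
  have hn := hP.left.nrm_eq_of_vert_eq hxK hsV.1 hs1
  refine (hP.left.inscribed hsV.1).not_nested hP.left hP.right (hP.right.inscribed hsL)
    (hP.side_eq hsV.1) (hP.sideDeriv_eq hsV.1) hs0 hsV.2.1 hs2 ?_ ?_
  · rw [hn]
    rw [h31] at hs3
    simp only [planeDet, PiLp.neg_apply] at hs3 ⊢; linarith
  · rw [hn, h11]
    rwa [one_mul] at ht1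

end IsCovariogramPair

/-! ### Equality of the normals -/

namespace IsCovariogramPair

variable {x : Plane}

lemma turnDomain_comm (hP : IsCovariogramPair K L) : turnDomain K L = turnDomain L K := by
  ext x
  simp only [turnDomain, Set.mem_ofPred_eq, hP.overlapDomain_eq, and_comm]

/-- The vectors at which the angle between corresponding normals is bounded away from `0` form
a compact set, since the normals agree in the limit at the boundary of the domain. -/
lemma isCompact_inner_le (hP : IsCovariogramPair K L) {c : ℝ} (hc : c < 1) :
    IsCompact {x | x ∈ turnDomain K L ∧ ⟪nrm K x 0, nrm L x 0⟫ ≤ c} := by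
  have hK := hP.left
  have hL := hP.right
  refine Metric.isCompact_of_isClosed_isBounded ?_ ?_
  · rw [isClosed_iff_ultrafilter]
    intro x₀ U hU hUS
    have hUK : overlapDomain K ∈ U := Filter.mem_of_superset hUS fun y hy => hy.1.1
    have hUL : overlapDomain L ∈ U := hP.overlapDomain_eq ▸ hUK
    by_cases hx₀ : x₀ ∈ overlapDomain K
    · have hx₀L : x₀ ∈ overlapDomain L := hP.overlapDomain_eq ▸ hx₀
      have H := hK.inscribed hx₀
      have H' := hL.inscribed hx₀L
      have tK := fun i => ((hK.continuousAt_nrm hx₀ i).tendsto).mono_left hU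
      have tL := fun i => ((hL.continuousAt_nrm hx₀L i).tendsto).mono_left hU
      have hle : ⟪nrm K x₀ 0, nrm L x₀ 0⟫ ≤ c := by
        refine le_of_tendsto ((tK 0).inner (𝕜 := ℝ) (tL 0)) ?_
        exact Filter.mem_of_superset hUS fun y hy => hy.2
      have hnn : nrm K x₀ 0 ≠ nrm L x₀ 0 := by
        intro h
        rw [h, real_inner_self_eq_norm_sq, H'.norm_normal, one_pow] at hle
        linarith
      have h1 : 0 ≤ planeDet (-nrm K x₀ 2) (nrm K x₀ 0) := by
        refine ge_of_tendsto ((tK 2).neg.planeDet (tK 0)) ?_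
        exact Filter.mem_of_superset hUS fun y hy => hy.1.2.1.le
      have h2 : 0 ≤ planeDet (-nrm L x₀ 2) (nrm L x₀ 0) := by
        refine ge_of_tendsto ((tL 2).neg.planeDet (tL 0)) ?_
        exact Filter.mem_of_superset hUS fun y hy => hy.1.2.2.le
      refine ⟨⟨hx₀, h1.lt_of_ne fun h => hnn ?_, h2.lt_of_ne fun h => hnn ?_⟩, hle⟩
      · have := unit_eq_of_planeDet_eq_zero (by rw [norm_neg]; exact H.norm_normal 2)
          (H.norm_normal 0) h.symm
          (by rw [inner_neg_left]; exact neg_pos.2 (H.inner_two_neg hK)) (H.inner_zero_pos hK)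
        exact (hP.nrm_eq_of_antipodal hx₀ this.symm).1.symm
      · have := unit_eq_of_planeDet_eq_zero (by rw [norm_neg]; exact H'.norm_normal 2)
          (H'.norm_normal 0) h.symm
          (by rw [inner_neg_left]; exact neg_pos.2 (H'.inner_two_neg hL)) (H'.inner_zero_pos hL)
        exact (hP.symm.nrm_eq_of_antipodal hx₀L this.symm).1
    · exfalso
      have := le_of_tendsto
        (tendsto_inner_nrm_one hK hL hP.interior_sub_eq hU hUK hUL hx₀)
        (Filter.mem_of_superset hUS fun y hy => hy.2)
      linarith
  · refine (hK.compact.isBounded.sub hK.compact.isBounded).subset ?_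
    rintro x ⟨⟨⟨-, z, hz, hzx⟩, -⟩, -⟩
    exact ⟨z, interior_subset hz, z - x, interior_subset hzx, sub_sub_cancel z x⟩

/-- By compactness the angle between corresponding normals would attain a positive maximum. -/
lemma nrm_zero_eq (hP : IsCovariogramPair K L) (hx : x ∈ turnDomain K L) :
    nrm K x 0 = nrm L x 0 := by
  have inner_one : ∀ z ∈ turnDomain K L, nrm K z 0 = nrm L z 0 → ⟪nrm K z 0, nrm L z 0⟫ = 1 := by
    intro z hz h
    rw [← h, real_inner_self_eq_norm_sq, (hP.left.inscribed hz.1).norm_normal, one_pow]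
  have hxL : x ∈ overlapDomain L := hP.overlapDomain_eq ▸ hx.1
  by_contra hne
  have hc : ⟪nrm K x 0, nrm L x 0⟫ < 1 :=
    inner_lt_one_iff_real_of_norm_eq_one ((hP.left.inscribed hx.1).norm_normal 0)
      ((hP.right.inscribed hxL).norm_normal 0) |>.2 hne
  have hcont : ContinuousOn (fun z => ⟪nrm K z 0, nrm L z 0⟫)
      {z | z ∈ turnDomain K L ∧ ⟪nrm K z 0, nrm L z 0⟫ ≤ ⟪nrm K x 0, nrm L x 0⟫} := by
    intro z hz
    exact (ContinuousAt.inner (𝕜 := ℝ) (f := fun z => nrm K z 0) (g := fun z => nrm L z 0)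
      (hP.left.continuousAt_nrm hz.1.1 0)
      (hP.right.continuousAt_nrm (hP.overlapDomain_eq ▸ hz.1.1) 0)).continuousWithinAt
  obtain ⟨m, ⟨hmT, hmc⟩, hmin⟩ := (hP.isCompact_inner_le hc).exists_isMinOn ⟨x, hx, le_rfl⟩ hcont
  have hmin' : ∀ z ∈ turnDomain K L, ⟪nrm K m 0, nrm L m 0⟫ ≤ ⟪nrm K z 0, nrm L z 0⟫ := by
    intro z hz
    rcases le_total ⟪nrm K z 0, nrm L z 0⟫ ⟪nrm K x 0, nrm L x 0⟫ with h | h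
    · exact hmin ⟨hz, h⟩
    · exact hmc.trans h
  have hmL : m ∈ overlapDomain L := hP.overlapDomain_eq ▸ hmT.1
  rcases lt_trichotomy (planeDet (nrm K m 0) (nrm L m 0)) 0 with h | h | h
  · refine hP.symm.not_isMin_of_pos (hP.turnDomain_comm ▸ hmT)
      (by rw [planeDet_swap]; exact neg_pos.2 h) fun z hz => ?_
    rw [real_inner_comm, real_inner_comm (nrm K z 0)]
    exact hmin' z (hP.turnDomain_comm ▸ hz)
  · have := inner_one m hmT <| unit_eq_of_planeDet_eq_zero
      ((hP.left.inscribed hmT.1).norm_normal 0) ((hP.right.inscribed hmL).norm_normal 0) h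
      ((hP.left.inscribed hmT.1).inner_zero_pos hP.left)
      ((hP.right.inscribed hmL).inner_zero_pos hP.right)
    linarith
  · exact hP.not_isMin_of_pos hmT h hmin'

lemma nrm_two_eq (hP : IsCovariogramPair K L) (hx : x ∈ turnDomain K L) :
    nrm K x 2 = nrm L x 2 := by
  have h00 := hP.nrm_zero_eq hx
  have hxL : x ∈ overlapDomain L := hP.overlapDomain_eq ▸ hx.1
  have H := hP.left.inscribed hx.1
  have H' := hP.right.inscribed hxL
  have h32 : planeDet (nrm K x 3) (nrm K x 2) < 0 := by
    rw [planeDet_swap]; exact neg_neg_of_pos (H.planeDet_two_three_pos hP.left)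
  have h32' : planeDet (nrm L x 3) (nrm L x 2) < 0 := by
    rw [planeDet_swap]; exact neg_neg_of_pos (H'.planeDet_two_three_pos hP.right)
  have d0 := H.planeDet_zero_one_pos hP.left
  have d0' := H'.planeDet_zero_one_pos hP.right
  rw [← h00] at d0'
  -- the vertex `0` moves in the same direction for both bodies, so the vertices `3` do as well
  have hE : obliqueProj (nrm K x 3) (nrm K x 2) (quarterTurn (nrm K x 0)) =
      obliqueProj (nrm L x 3) (nrm L x 2) (quarterTurn (nrm K x 0)) := by
    have := congrArg (fun T : Plane →L[ℝ] Plane => T (quarterTurn (nrm K x 0)))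
      (hP.sideDeriv_eq hx.1)
    simp only [sideDeriv, sub_apply] at this
    rw [obliqueProj_apply (nrm K x 0), obliqueProj_apply (nrm L x 0), ← h00, inner_quarterTurn,
      inner_quarterTurn, div_self d0.ne', div_self d0'.ne'] at this
    exact sub_right_injective this
  have h02 : 0 < planeDet (nrm K x 0) (nrm K x 2) := by
    have := hx.2.1
    simp only [planeDet, PiLp.neg_apply] at this ⊢; linarith
  obtain ⟨-, hprod⟩ := obliqueProj_quarterTurn_eq (H.norm_normal 3) (H'.norm_normal 3)
    (H.inner_three_pos hP.left) (H'.inner_three_pos hP.right) h32.ne h32'.ne h02.ne' hE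
  have h03 : planeDet (nrm K x 0) (nrm K x 3) ≠ 0 := by
    have h1 := planeDet_mul_planeDet (nrm K x 0) (nrm K x 3) x (vert K x 0 - vert K x 3)
    have h2 := mul_neg_of_pos_of_neg (H.inner_zero_pos hP.left) (H.inner_three_side_neg hP.left)
    have h3 := mul_pos (H.inner_zero_side_pos hP.left) (H.inner_three_pos hP.left)
    intro h
    rw [h] at h1
    linarith
  refine unit_eq_of_planeDet_eq_zero (H.norm_normal 2) (H'.norm_normal 2)
    ((mul_eq_zero.1 hprod).resolve_left h03) (w := -x) ?_ ?_ <;> rw [inner_neg_right, neg_pos]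
  exacts [H.inner_two_neg hP.left, H'.inner_two_neg hP.right]

end IsCovariogramPair

lemma covariogram_neg (hK : IsCompact K) : covariogram (-K) = covariogram K := by
  ext x
  rw [covariogram_eq, covariogram_eq, MeasureTheory.measureReal_def,
    MeasureTheory.measureReal_def]
  have hm : MeasurableSet (K ∩ {z | z - x ∈ K}) :=
    (hK.isClosed.inter (hK.isClosed.preimage (by fun_prop))).measurableSet
  rw [← (MeasureTheory.Measure.measurePreserving_sub_left MeasureTheory.volume x).measure_preimage
    hm.nullMeasurableSet]
  congr 2
  ext z
  simp [and_comm]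

namespace IsInscribedParallelogram

variable {x : Plane} {p u q v : Fin 4 → Plane}

lemma nrm_eq (hK : IsSmoothBody K) (H : IsInscribedParallelogram K x p u) : nrm K x = u :=
  (hK.inscribed_unique (hK.inscribed (H.mem_overlapDomain hK)) H).2

lemma normals_eq_of_pos (hP : IsCovariogramPair K L) (H : IsInscribedParallelogram K x p u)
    (H' : IsInscribedParallelogram L x q v) (hu : 0 < planeDet (-u 2) (u 0))
    (hv : 0 < planeDet (-v 2) (v 0)) : u 0 = v 0 ∧ u 2 = v 2 := by
  have hx : x ∈ turnDomain K L := ⟨H.mem_overlapDomain hP.left,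
    by rwa [H.nrm_eq hP.left], by rwa [H'.nrm_eq hP.right]⟩
  have h0 := hP.nrm_zero_eq hx
  have h2 := hP.nrm_two_eq hx
  rw [H.nrm_eq hP.left, H'.nrm_eq hP.right] at h0 h2
  exact ⟨h0, h2⟩

/-- The hypothesis on the Hessian excludes antipodal normals at opposite vertices. -/
lemma planeDet_neg_ne_zero (hK : IsSmoothBody K) (H : IsInscribedParallelogram K x p u)
    (hdet : (hessianMatrix (covariogram K) x).det ≠ -1) : planeDet (-u 2) (u 0) ≠ 0 := by
  intro h
  have := unit_eq_of_planeDet_eq_zero (by rw [norm_neg]; exact H.norm_normal 2)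
    (H.norm_normal 0) h (by rw [inner_neg_left]; exact neg_pos.2 (H.inner_two_neg hK))
    (H.inner_zero_pos hK)
  refine hdet (hK.det_hessianMatrix_of_antipodal (H.mem_overlapDomain hK) ?_)
  rw [H.nrm_eq hK]; exact this.symm

/-- Reflecting a body in the origin exchanges the normals at opposite vertices up to sign, so the
general case reduces to the one where `-u 2, u 0` and `-v 2, v 0` are positively oriented. -/
lemma normals_pair_eq (hP : IsCovariogramPair K L) (H : IsInscribedParallelogram K x p u)
    (H' : IsInscribedParallelogram L x q v)
    (hdet : (hessianMatrix (covariogram K) x).det ≠ -1) :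
    ({u 0, -u 2} : Set Plane) = {v 0, -v 2} := by
  have hu := H.planeDet_neg_ne_zero hP.left hdet
  have hv := H'.planeDet_neg_ne_zero hP.right (hP.covariogram_eq ▸ hdet)
  have flip : ∀ w : Fin 4 → Plane, planeDet (-w 2) (w 0) < 0 →
      0 < planeDet (- -w (2 + 2)) (-w (0 + 2)) := fun w h => by
    change 0 < planeDet (- -w 0) (-w 2)
    rw [neg_neg, planeDet_swap]; exact neg_pos.2 h
  have cK := covariogram_neg hP.left.compact
  have cL := covariogram_neg hP.right.compact
  rcases hu.lt_or_gt with hu | hu <;> rcases hv.lt_or_gt with hv | hv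
  · obtain ⟨h0, h2⟩ := normals_eq_of_pos ⟨hP.left.neg, hP.right.neg, by
      rw [cK, cL, hP.covariogram_eq]⟩ H.neg H'.neg (flip u hu) (flip v hv)
    change -u 2 = -v 2 at h0
    change -u 0 = -v 0 at h2
    rw [h0, neg_inj.1 h2]
  · obtain ⟨h0, h2⟩ := normals_eq_of_pos ⟨hP.left.neg, hP.right, by
      rw [cK, hP.covariogram_eq]⟩ H.neg H' (flip u hu) hv
    change -u 2 = v 0 at h0
    change -u 0 = v 2 at h2
    rw [h0, ← h2, neg_neg, Set.pair_comm]
  · obtain ⟨h0, h2⟩ := normals_eq_of_pos ⟨hP.left, hP.right.neg, by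
      rw [cL, hP.covariogram_eq]⟩ H H'.neg hu (flip v hv)
    change u 0 = -v 2 at h0
    change u 2 = -v 0 at h2
    rw [h0, h2, neg_neg, Set.pair_comm]
  · obtain ⟨h0, h2⟩ := normals_eq_of_pos hP H H' hu hv
    rw [h0, h2]

end IsInscribedParallelogram

lemma IsSmoothBody.existsUnique_inscribed (hK : IsSmoothBody K) {x : Plane}
    (hx : x ∈ overlapDomain K) : ∃! d : (Fin 4 → Plane) × (Fin 4 → Plane),
      IsInscribedParallelogram K x d.1 d.2 := by
  obtain ⟨p, u, H⟩ := hK.exists_inscribed hx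
  refine ⟨(p, u), H, fun d hd => ?_⟩
  obtain ⟨h1, h2⟩ := hK.inscribed_unique hd H
  exact Prod.ext h1 h2

end

theorem mainTheorem3
    (K : ConvexBody Plane)
    (hKint : (interior (K : Set Plane)).Nonempty)
    (hKstrict : StrictConvex ℝ (K : Set Plane))
    (hKreg : IsC1Regular (K : Set Plane))
    (x : Plane)
    (hx : x ∈ interior (tsupport (covariogram (K : Set Plane))) \ {0})
    (hdet : (hessianMatrix (covariogram (K : Set Plane)) x).det ≠ -1) :
    (∃! d : (Fin 4 → Plane) × (Fin 4 → Plane),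
      IsInscribedParallelogram (K : Set Plane) x d.1 d.2) ∧
    ∀ L : ConvexBody Plane,
      (interior (L : Set Plane)).Nonempty →
      StrictConvex ℝ (L : Set Plane) →
      IsC1Regular (L : Set Plane) →
      covariogram (L : Set Plane) = covariogram (K : Set Plane) →
      (∃! d : (Fin 4 → Plane) × (Fin 4 → Plane),
        IsInscribedParallelogram (L : Set Plane) x d.1 d.2) ∧
      ∀ p u q v : Fin 4 → Plane,
        IsInscribedParallelogram (K : Set Plane) x p u →
        IsInscribedParallelogram (L : Set Plane) x q v →
        ({u 0, -u 2} : Set Plane) = {v 0, -v 2} := by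
  have hK : IsSmoothBody (K : Set Plane) := ⟨K.isCompact, K.convex, hKint, hKstrict, hKreg⟩
  have hxK := hK.mem_overlapDomain hx
  refine ⟨hK.existsUnique_inscribed hxK, fun L hLint hLstrict hLreg hcov => ?_⟩
  have hL : IsSmoothBody (L : Set Plane) := ⟨L.isCompact, L.convex, hLint, hLstrict, hLreg⟩
  have hP : IsCovariogramPair (K : Set Plane) (L : Set Plane) := ⟨hK, hL, hcov.symm⟩
  exact ⟨hL.existsUnique_inscribed (hP.overlapDomain_eq ▸ hxK),
    fun p u q v H H' => H.normals_pair_eq hP H' hdet⟩
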